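/- For a Coxeter matrix $M=(m_{ij})_{i,j\in I}$ with Coxeter group $W(M)=\langle s_i\mid (s_is_j)^{m_{ij}}=1\rangle$, the Hecke monoid $(W(M),\star)$ is the monoid generated by $s_i$, $i\in I$, subject to $s_i\star s_i=s_i$ and the braid relations $s_i\star s_j\star s_i\star\cdots=s_j\star s_i\star s_j\star\cdots$ ($m_{ij}$ factors on each side, $i\ne j$, $m_{ij}<\infty$). It is identified with $W(M)$ as a set, via reduced expressions. For $J\subset I$ let $W_J(M)$ be generated by the $s_j$, $j\in J$; $J$ is of finite type if $W_J(M)$ is finite, and then $w_\circ^J$ denotes the longest element of $W_J(M)$. For $J\subset K$ with $K$ of finite type, put $w_{J;K}=w_\circ^Jw_\circ^K$ (product in the Coxeter group). The support $\operatorname{supp}x$ is the smallest $J$ with $x\in W_J(M)$. Join $i\neq j$ by an edge if $m_{ij}>2$; $J\subset I$ is connected if it is not a disjoint union of two non-empty subsets with no edge between them. Let $M'$, $M$ be Coxeter matrices over $I'$, $I$, with generators $s'_i$ and $s_i$ respectively. For a homomorphism $\phi:(W(M'),\star)\to(W(M),\star)$ and $J'\subset I'$ put $[\phi](J')=\bigcup_{j\in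 J'}\operatorname{supp}\phi(s'_j)$. Call $\phi$ fully supported if $[\phi](I')=I$; connected if $[\phi]$ maps connected subsets to connected subsets; locally injective if its restriction to $W_{\{i,j\}}(M')$ is injective for all $i\ne j\in I'$; parabolic if for every $K'\subset I'$ of finite type and every $J'\subset K'$ there is $J\subset[\phi](K')$ with $\phi(w_{J';K'})=w_{J;[\phi](K')}$. A diagram automorphism is the automorphism $s_i\mapsto s_{\sigma(i)}$ attached to a permutation $\sigma$ of $I$ with $m_{\sigma(i)\sigma(j)}=m_{ij}$ for all $i,j$. Let $\mathcal A_r(m)$ be the set of $\boldsymbol\lambda=(\lambda_1,\dots,\lambda_r)\in\mathbb Z_{>0}^r$ with $\sum_j\lambda_j=m$, $\lambda_1\ge\dots\ge\lambda_r$ and $\lambda_1=\dots=\lambda_{r-2}$. Put $a_0(\boldsymbol\lambda)=0$, $a_i(\boldsymbol\lambda)=\lambda_r+\sum_{1\le j\le i-1}\lambda_j$ for $1\le i\le r$, and $J_i(\boldsymbol\lambda)=[a_{i-1}(\boldsymbol\lambda)+1,\,a_{i+1}(\boldsymbol\lambda)-1]$ for $1\le i\le r-1$. Let $A_n$ be the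 Coxeter matrix of type $A_n$ over $[1,n]=\{1,\dots,n\}$ in the standard labelling. **Theorem.** (1) Let $k,n\ge 1$. For every $\boldsymbol\lambda\in\mathcal A_{k+1}(n+1)$ the assignments $s'_i\mapsto w_\circ^{J_i(\boldsymbol\lambda)}$, $1\le i\le k$, define a (unique) homomorphism $\psi_{\boldsymbol\lambda}:(W(A_k),\star)\to(W(A_n),\star)$, and $\psi_{\boldsymbol\lambda}$ is locally injective and connected. Conversely, if $\phi:(W(A_k),\star)\to(W(A_n),\star)$ is a locally injective, connected and fully supported homomorphism, then $\phi=\sigma\circ\psi_{\boldsymbol\lambda}\circ\sigma'$ for some $\boldsymbol\lambda\in\mathcal A_{k+1}(n+1)$ and some diagram automorphisms $\sigma$ of $(W(A_n),\star)$ and $\sigma'$ of $(W(A_k),\star)$. (2) Let $k=2$ and $n\ge 2$. For every $\boldsymbol\lambda\in\mathcal A_3(n+1)$ the homomorphism $\psi_{\boldsymbol\lambda}$ is injective, and it is parabolic if and only if $\boldsymbol\lambda=(n-1,1,1)$. Conversely, if $\phi:(W(A_2),\star)\to(W(A_n),\star)$ is an injective, connected and fully supported homomorphism, then $\phi=\sigma\circ\psi_{\boldsymbol\lambda}\circ\sigma'$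 for some $\boldsymbol\lambda\in\mathcal A_3(n+1)$ and some diagram automorphisms $\sigma$, $\sigma'$ as in (1). -/

import Mathlib

namespace HeckeMonoid

/-- The defining relations of the Hecke monoid of a Coxeter matrix `M`: the generators are
idempotent and satisfy the braid relations. In Mathlib `M i j = 0` encodes `m_{ij} = ∞`; the
braid words are then empty and the relation is trivial. -/
inductive Rel {B : Type*} (M : CoxeterMatrix B) : FreeMonoid B → FreeMonoid B → Prop
  | idem (i : B) : Rel M (FreeMonoid.of i * FreeMonoid.of i) (FreeMonoid.of i)
  | braid (i j : B) :
      Rel M (FreeMonoid.ofList (CoxeterSystem.braidWord M i j))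
        (FreeMonoid.ofList (CoxeterSystem.braidWord M j i))

/-- The Hecke monoid `(W(M), ⋆)`, by generators and relations. -/
abbrev Hecke {B : Type*} (M : CoxeterMatrix B) : Type _ := PresentedMonoid (Rel M)

/-- The standard generators of the Hecke monoid. -/
def gen {B : Type*} (M : CoxeterMatrix B) (i : B) : Hecke M := PresentedMonoid.of (Rel M) i

/-- The canonical bijection from the Coxeter group `W(M)` to the Hecke monoid: it sends `w` to the
`⋆`-product of the generators along a reduced word of `w`. By Matsumoto's theorem the result does
not depend on the reduced word. -/
noncomputable def ofGroup {B : Type*} {M : CoxeterMatrix B} (w : M.Group) : Hecke M :=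
  ((M.toCoxeterSystem.exists_isReduced w).choose.map (gen M)).prod

/-- The parabolic subgroup `W_J(M)` of the Coxeter group. -/
def parabolicSubgroup {B : Type*} (M : CoxeterMatrix B) (J : Set B) : Subgroup M.Group :=
  Subgroup.closure (M.simple '' J)

/-- The parabolic submonoid `W_J(M)` of the Hecke monoid. -/
def parabolicSubmonoid {B : Type*} (M : CoxeterMatrix B) (J : Set B) : Submonoid (Hecke M) :=
  Submonoid.closure (gen M '' J)

/-- `J` is of finite type if `W_J(M)` is finite. -/
def FiniteType {B : Type*} (M : CoxeterMatrix B) (J : Set B) : Prop :=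
  Finite (parabolicSubgroup M J)

/-- `w` is an element of maximal length in `W_J(M)`. -/
def IsLongest {B : Type*} (M : CoxeterMatrix B) (J : Set B) (w : M.Group) : Prop :=
  w ∈ parabolicSubgroup M J ∧
    ∀ v ∈ parabolicSubgroup M J, M.toCoxeterSystem.length v ≤ M.toCoxeterSystem.length w

open Classical in
/-- The longest element `w_∘^J` of the parabolic subgroup `W_J(M)`. It exists and is unique when
`J` is of finite type; otherwise the value is the irrelevant `1`. -/
noncomputable def longest {B : Type*} (M : CoxeterMatrix B) (J : Set B) : M.Group :=
  if h : ∃ w, IsLongest M J w then h.choose else 1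

/-- The parabolic element `w_{J;K} = w_∘^J w_∘^K`, the product being taken in the Coxeter group. -/
noncomputable def parabolicElement {B : Type*} (M : CoxeterMatrix B) (J K : Set B) : M.Group :=
  longest M J * longest M K

/-- The support of an element `x` of the Hecke monoid: the intersection of all `J` such that `x`
lies in the parabolic submonoid of `J`. -/
def supp {B : Type*} {M : CoxeterMatrix B} (x : Hecke M) : Set B :=
  ⋂ (J : Set B) (_ : x ∈ parabolicSubmonoid M J), J

/-- The Coxeter graph (without labels): `i` and `j` are joined if and only if `m_{ij} > 2`
(including `m_{ij} = ∞`). -/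
def coxeterGraph {B : Type*} (M : CoxeterMatrix B) : SimpleGraph B where
  Adj i j := i ≠ j ∧ M i j ≠ 2
  symm := ⟨fun i j h => ⟨h.1.symm, by rw [M.symmetric]; exact h.2⟩⟩
  loopless := ⟨fun _ h => h.1 rfl⟩

/-- `J` is a connected subset of the index set: it is not a disjoint union of two non-empty
orthogonal subsets. (In particular `∅` is connected.) -/
def ConnectedSubset {B : Type*} (M : CoxeterMatrix B) (J : Set B) : Prop :=
  ((coxeterGraph M).induce J).Preconnected

/-- The map `[φ]` from subsets of `I'` to subsets of `I` that is attached to `φ`. -/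
def suppMap {B' B : Type*} {M' : CoxeterMatrix B'} {M : CoxeterMatrix B}
    (φ : Hecke M' →* Hecke M) (J : Set B') : Set B :=
  ⋃ j ∈ J, supp (φ (gen M' j))

/-- `φ` is fully supported. -/
def FullySupported {B' B : Type*} {M' : CoxeterMatrix B'} {M : CoxeterMatrix B}
    (φ : Hecke M' →* Hecke M) : Prop :=
  suppMap φ Set.univ = Set.univ

/-- `φ` is connected: `[φ]` maps connected subsets to connected subsets. -/
def IsConnectedHom {B' B : Type*} {M' : CoxeterMatrix B'} {M : CoxeterMatrix B}
    (φ : Hecke M' →* Hecke M) : Prop :=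
  ∀ J : Set B', ConnectedSubset M' J → ConnectedSubset M (suppMap φ J)

/-- `φ` is locally injective: its restrictions to the parabolic submonoids of rank two are
injective. -/
def LocallyInjective {B' B : Type*} {M' : CoxeterMatrix B'} {M : CoxeterMatrix B}
    (φ : Hecke M' →* Hecke M) : Prop :=
  ∀ i j : B', i ≠ j → Set.InjOn φ (parabolicSubmonoid M' {i, j} : Set (Hecke M'))

/-- `φ` is parabolic: for every `K'` of finite type it maps each `K'`-parabolic element to a
`[φ](K')`-parabolic element. -/
def IsParabolic {B' B : Type*} {M' : CoxeterMatrix B'} {M : CoxeterMatrix B}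
    (φ : Hecke M' →* Hecke M) : Prop :=
  ∀ K' : Set B', FiniteType M' K' → ∀ J' ⊆ K', ∃ J ⊆ suppMap φ K',
    φ (ofGroup (parabolicElement M' J' K')) = ofGroup (parabolicElement M J (suppMap φ K'))

/-- Automorphisms of the labelled Coxeter graph. -/
abbrev DiagramAut {B : Type*} (M : CoxeterMatrix B) : Type _ :=
  {σ : Equiv.Perm B // ∀ i j, M (σ i) (σ j) = M i j}

theorem map_alternatingWord {B B' : Type*} (f : B → B') (m : ℕ) (i j : B) :
    (CoxeterSystem.alternatingWord i j m).map f =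
      CoxeterSystem.alternatingWord (f i) (f j) m := by
  induction m generalizing i j with
  | zero => rfl
  | succ m ih => simp [CoxeterSystem.alternatingWord_succ, ih]

theorem diagram_rel {B : Type*} {M : CoxeterMatrix B} (σ : DiagramAut M) (a b : FreeMonoid B)
    (h : Rel M a b) :
    FreeMonoid.lift (fun i => gen M (σ.1 i)) a = FreeMonoid.lift (fun i => gen M (σ.1 i)) b := by
  have key : ∀ c : FreeMonoid B, FreeMonoid.lift (fun i => gen M (σ.1 i)) c =
      PresentedMonoid.mk (Rel M) (FreeMonoid.map σ.1 c) := by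
    intro c
    have : FreeMonoid.lift (fun i => gen M (σ.1 i)) =
        (PresentedMonoid.mk (Rel M)).comp (FreeMonoid.map σ.1) := by
      apply FreeMonoid.hom_eq
      intro i
      simp [gen, PresentedMonoid.of]
    rw [this]
    rfl
  rw [key, key]
  apply PresentedMonoid.mk_eq_mk_of_rel
  cases h with
  | idem i => simpa using Rel.idem (σ.1 i)
  | braid i j =>
    have h := Rel.braid (M := M) (σ.1 i) (σ.1 j)
    simp only [CoxeterSystem.braidWord, σ.2] at h
    simpa [CoxeterSystem.braidWord, ← FreeMonoid.ofList_map, map_alternatingWord] using h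

/-- The endomorphism (in fact automorphism) of the Hecke monoid induced by a diagram automorphism:
`s_i ↦ s_{σ(i)}`. -/
def diagramHom {B : Type*} {M : CoxeterMatrix B} (σ : DiagramAut M) : Hecke M →* Hecke M :=
  PresentedMonoid.lift (fun i => gen M (σ.1 i)) (diagram_rel σ)

/-- The set `𝒜_r(m)` of partitions of `m` with exactly `r` parts
`λ₁ = ⋯ = λ_{r-2} ≥ λ_{r-1} ≥ λ_r > 0`; the part `λ_{j+1}` is `l j`. -/
def restrictedPartitions (r m : ℕ) : Set (Fin r → ℕ) :=
  {l | (∀ j, 0 < l j) ∧ Antitone l ∧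
    (∀ i j : Fin r, (i : ℕ) + 2 < r → (j : ℕ) + 2 < r → l i = l j) ∧ ∑ j, l j = m}

/-- For `λ = (λ₁, …, λ_r)` with `r = k + 1`: `a_0(λ) = 0` and
`a_i(λ) = λ_r + λ_1 + ⋯ + λ_{i-1}` for `1 ≤ i ≤ r`. -/
def partialSum {k : ℕ} (l : Fin (k + 1) → ℕ) (i : ℕ) : ℕ :=
  if i = 0 then 0 else
    l (Fin.last k) + ∑ j ∈ Finset.univ.filter (fun j : Fin (k + 1) => (j : ℕ) + 1 < i), l j

/-- The interval `J_i(λ) = [a_{i-1}(λ) + 1, a_{i+1}(λ) - 1]` in `[1, n]`, for `1 ≤ i ≤ k`. The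
indices `i` and `x` of the text are `(i : ℕ) + 1` and `(x : ℕ) + 1` here. -/
def interval (n : ℕ) {k : ℕ} (l : Fin (k + 1) → ℕ) (i : Fin k) : Set (Fin n) :=
  {x | partialSum l (i : ℕ) + 1 ≤ (x : ℕ) + 1 ∧ (x : ℕ) + 1 < partialSum l ((i : ℕ) + 2)}

/-- `ψ` is the homomorphism `ψ_λ` given by `s'_i ↦ w_∘^{J_i(λ)}`. -/
def IsPsi {k n : ℕ} (l : Fin (k + 1) → ℕ)
    (ψ : Hecke (CoxeterMatrix.A k) →* Hecke (CoxeterMatrix.A n)) : Prop :=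
  ∀ i : Fin k, ψ (gen (CoxeterMatrix.A k) i) =
    ofGroup (longest (CoxeterMatrix.A n) (interval n l i))

/-- Up to compositions with diagram automorphisms of `A_k` and of `A_n`, `φ` is `ψ_λ` for some
`λ ∈ 𝒜_{k+1}(n+1)`. -/
def IsPsiUpToDiagramAut {k n : ℕ}
    (φ : Hecke (CoxeterMatrix.A k) →* Hecke (CoxeterMatrix.A n)) : Prop :=
  ∃ l ∈ restrictedPartitions (k + 1) (n + 1),
    ∃ ψ : Hecke (CoxeterMatrix.A k) →* Hecke (CoxeterMatrix.A n), IsPsi l ψ ∧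
      ∃ (σ : DiagramAut (CoxeterMatrix.A n)) (σ' : DiagramAut (CoxeterMatrix.A k)),
        φ = (diagramHom σ).comp (ψ.comp (diagramHom σ'))

end HeckeMonoid

/-! In type A the Hecke monoid is bubble sort. Record a permutation `w`, for each threshold `t`, by
the 0/1 word of the truth values of `t ≤ w x`, or by its partial sums: a height function with steps
0 and 1. A generator sorts two neighbouring letters, 1 before 0, raising one height as far as its
neighbours allow. With Matsumoto's theorem (`Asc.unique`) this identifies the monoid with the
symmetric group and makes the action faithful (`hecke_ext`). Identities between products thus become
min-plus identities between heights.

Multiplication never lowers heights. So if x is idempotent and s is a letter of a word for x, then x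
is squeezed between equal heights and x s = x: every idempotent is the zero of the parabolic
submonoid of its support, that is, its longest element (`absorbs_of_idem`). A homomorphism is
therefore encoded by the supports of the images of the generators. Connectedness makes these
intervals, and the longest element of an interval sorts a window of consecutive places completely
(`Absorbs.act_cutSet`).

Nested windows absorb and disjoint windows commute. Two properly overlapping windows cut their union
into blocks of sizes A, B, C; they do not commute, and they satisfy the braid relation if and only
if A ≤ B and C ≤ B (`braid_of_overlap`, `overlap_of_braid`). Under local injectivity, adjacent
generators thus give overlapping windows of this kind and non-adjacent ones give disjoint windows.
Hence the windows march in one direction, and window i ends exactly where window i+2 starts, at the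
midpoint of window i+1 (`exists_isChain`). The resulting cut points form an `IsChain`: inner blocks
are equal and the two outer blocks are no longer than an adjacent inner one. Up to reversal this is
a restricted partition, and conversely each chain satisfies the relations.

For k = 2, parabolicity hinges on the images of the two elements of length two. Undoing the reversal
in such an image leaves a permutation that exchanges two blocks and keeps the order inside each; it
is a longest element only if both blocks are single points (`one_of_parabolic`), which forces λ =
(n-1, 1, 1). -/

namespace HeckeMonoid

/-! ### Families satisfying the braid relations of type `A` -/

/-- A family of elements of a monoid that satisfies the braid relations of type `A_n`. -/
structure BraidFamily {n : ℕ} {N : Type*} [Monoid N] (f : Fin n → N) : Prop where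
  comm : ∀ i j : Fin n, (i : ℕ) + 1 < j → f i * f j = f j * f i
  braid : ∀ i j : Fin n, (i : ℕ) + 1 = j → f i * f j * f i = f j * f i * f j

theorem A_adj {n : ℕ} {i j : Fin n} (h : (i : ℕ) + 1 = j) : CoxeterMatrix.A n i j = 3 := by
  have hij : i ≠ j := by rintro rfl; omega
  simp [CoxeterMatrix.A, hij, h]

theorem A_far {n : ℕ} {i j : Fin n} (h : (i : ℕ) + 1 < j) : CoxeterMatrix.A n i j = 2 := by
  have hij : i ≠ j := by rintro rfl; omega
  have h1 : ¬ ((j : ℕ) + 1 = i ∨ (i : ℕ) + 1 = j) := by omega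
  simp [CoxeterMatrix.A, hij, h1]

theorem gen_idem {B : Type*} (M : CoxeterMatrix B) (i : B) : gen M i * gen M i = gen M i :=
  PresentedMonoid.mk_eq_mk_of_rel (Rel.idem i)

theorem prod_map_gen {B : Type*} (M : CoxeterMatrix B) (l : List B) :
    (l.map (gen M)).prod = PresentedMonoid.mk (Rel M) (FreeMonoid.ofList l) := by
  induction l with
  | nil => rfl
  | cons a l ih => rw [List.map_cons, List.prod_cons, ih, FreeMonoid.ofList_cons, map_mul]; rfl

theorem braidFamily_gen (n : ℕ) : BraidFamily (gen (CoxeterMatrix.A n)) where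
  comm i j h := by
    have h1 := PresentedMonoid.mk_eq_mk_of_rel (Rel.braid (M := CoxeterMatrix.A n) i j)
    rw [← prod_map_gen, ← prod_map_gen, CoxeterSystem.braidWord, CoxeterSystem.braidWord,
      (CoxeterMatrix.A n).symmetric j i, A_far h] at h1
    simpa [CoxeterSystem.alternatingWord] using h1
  braid i j h := by
    have h1 := PresentedMonoid.mk_eq_mk_of_rel (Rel.braid (M := CoxeterMatrix.A n) i j)
    rw [← prod_map_gen, ← prod_map_gen, CoxeterSystem.braidWord, CoxeterSystem.braidWord,
      (CoxeterMatrix.A n).symmetric j i, A_adj h] at h1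
    simpa [CoxeterSystem.alternatingWord, mul_assoc] using h1.symm

theorem braidFamily_simple (n : ℕ) : BraidFamily (CoxeterMatrix.A n).simple where
  comm i j h := by
    have h1 := (CoxeterMatrix.A n).toCoxeterSystem.wordProd_braidWord_eq i j
    rw [CoxeterSystem.braidWord, CoxeterSystem.braidWord,
      (CoxeterMatrix.A n).symmetric j i, A_far h] at h1
    simpa [CoxeterSystem.alternatingWord, CoxeterSystem.wordProd] using h1
  braid i j h := by
    have h1 := (CoxeterMatrix.A n).toCoxeterSystem.wordProd_braidWord_eq i j
    rw [CoxeterSystem.braidWord, CoxeterSystem.braidWord,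
      (CoxeterMatrix.A n).symmetric j i, A_adj h] at h1
    simpa [CoxeterSystem.alternatingWord, CoxeterSystem.wordProd, mul_assoc] using h1.symm

/-- The homomorphism from the Hecke monoid of type `A_k` attached to a family of idempotents that
satisfies the braid relations. -/
theorem exists_heckeHom {k : ℕ} {N : Type*} [Monoid N] {f : Fin k → N} (hf : BraidFamily f)
    (hi : ∀ i, f i * f i = f i) :
    ∃ φ : Hecke (CoxeterMatrix.A k) →* N, ∀ i, φ (gen (CoxeterMatrix.A k) i) = f i := by
  refine ⟨PresentedMonoid.lift f ?_, fun i => rfl⟩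
  intro a b h
  cases h with
  | idem i => simpa using hi i
  | braid i j =>
    rw [FreeMonoid.lift_ofList, FreeMonoid.lift_ofList, CoxeterSystem.braidWord,
      CoxeterSystem.braidWord, (CoxeterMatrix.A k).symmetric j i]
    rcases lt_trichotomy i j with h | rfl | h
    · have h' : (i : ℕ) < j := h
      rcases Nat.lt_or_ge ((i : ℕ) + 1) j with h2 | h2
      · rw [A_far h2]; simpa [CoxeterSystem.alternatingWord] using hf.comm i j h2
      · rw [A_adj (by omega : (i : ℕ) + 1 = j)]
        simpa [CoxeterSystem.alternatingWord, mul_assoc] using (hf.braid i j (by omega)).symm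
    · rfl
    · have h' : (j : ℕ) < i := h
      rw [(CoxeterMatrix.A k).symmetric i j]
      rcases Nat.lt_or_ge ((j : ℕ) + 1) i with h2 | h2
      · rw [A_far h2]; simpa [CoxeterSystem.alternatingWord] using (hf.comm j i h2).symm
      · rw [A_adj (by omega : (j : ℕ) + 1 = i)]
        simpa [CoxeterSystem.alternatingWord, mul_assoc] using hf.braid j i (by omega)

theorem heckeHom_ext {B : Type*} {M : CoxeterMatrix B} {N : Type*} [Monoid N]
    {φ ψ : Hecke M →* N} (h : ∀ i, φ (gen M i) = ψ (gen M i)) : φ = ψ := by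
  apply MonoidHom.eq_of_eqOn_denseM (PresentedMonoid.closure_range_of (Rel M))
  rintro _ ⟨i, rfl⟩
  exact h i

theorem exists_word {B : Type*} {M : CoxeterMatrix B} (x : Hecke M) :
    ∃ l : List B, x = (l.map (gen M)).prod := by
  obtain ⟨a, rfl⟩ := PresentedMonoid.surjective_mk x
  exact ⟨FreeMonoid.toList a, by rw [prod_map_gen]; rfl⟩

/-! ### Ascending factorizations of permutations -/

/-- The transposition of two consecutive points. -/
def adjSwap {n : ℕ} (i : Fin n) : Equiv.Perm (Fin (n + 1)) := Equiv.swap i.castSucc i.succ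

@[simp] theorem adjSwap_castSucc {n : ℕ} (i : Fin n) : adjSwap i i.castSucc = i.succ :=
  Equiv.swap_apply_left _ _

@[simp] theorem adjSwap_succ {n : ℕ} (i : Fin n) : adjSwap i i.succ = i.castSucc :=
  Equiv.swap_apply_right _ _

theorem adjSwap_of_ne {n : ℕ} {i : Fin n} {x : Fin (n + 1)} (h1 : (x : ℕ) ≠ i)
    (h2 : (x : ℕ) ≠ i + 1) : adjSwap i x = x :=
  Equiv.swap_apply_of_ne_of_ne (fun h => h1 (by simp [h])) (fun h => h2 (by simp [h]))

@[simp] theorem adjSwap_mul_self {n : ℕ} (i : Fin n) : adjSwap i * adjSwap i = 1 :=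
  Equiv.swap_mul_self _ _

theorem adjSwap_val {n : ℕ} (i : Fin n) (x : Fin (n + 1)) :
    (adjSwap i x : ℕ) = if (x : ℕ) = i then (i : ℕ) + 1 else if (x : ℕ) = i + 1 then i else x := by
  by_cases h1 : (x : ℕ) = i
  · obtain rfl : x = i.castSucc := Fin.ext h1
    simp
  · by_cases h2 : (x : ℕ) = i + 1
    · obtain rfl : x = i.succ := Fin.ext h2
      simp
    · simp [adjSwap_of_ne h1 h2, h1, h2]

theorem braidFamily_adjSwap (n : ℕ) : BraidFamily (adjSwap (n := n)) where
  comm i j h := by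
    apply Equiv.Perm.Disjoint.commute
    intro x
    by_cases hx : (x : ℕ) = i ∨ (x : ℕ) = i + 1
    · exact Or.inr (adjSwap_of_ne (by omega) (by omega))
    · exact Or.inl (adjSwap_of_ne (by omega) (by omega))
  braid i j h := by
    ext x
    have h1 : (j : ℕ) ≠ i := by omega
    have h2 : (j : ℕ) + 1 ≠ i := by omega
    rcases eq_or_ne (x : ℕ) i with hx | hx
    · simp [adjSwap_val, hx, h, h1.symm, h2, h2.symm]
    rcases eq_or_ne (x : ℕ) j with hx1 | hx1
    · simp [adjSwap_val, hx1, h, h1, h1.symm, h2, h2.symm]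
    rcases eq_or_ne (x : ℕ) (j + 1) with hx2 | hx2
    · simp [adjSwap_val, hx2, h, h1, h1.symm, h2, h2.symm]
    · simp [adjSwap_val, hx, hx1, hx2, h]

/-- `Asc f w x`: there is a word `i₁ … i_l` such that `w = s_{i₁} ⋯ s_{i_l}`, each partial product
is longer than the previous one, and `x = f i₁ ⋯ f i_l`. -/
inductive Asc {n : ℕ} {N : Type*} [Monoid N] (f : Fin n → N) :
    Equiv.Perm (Fin (n + 1)) → N → Prop
  | one : Asc f 1 1
  | step {w : Equiv.Perm (Fin (n + 1))} {x : N} (i : Fin n) :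
      Asc f w x → w i.castSucc < w i.succ → Asc f (w * adjSwap i) (x * f i)

section Asc

variable {n : ℕ} {N : Type*} [Monoid N] {f : Fin n → N}

theorem Asc.step' {w : Equiv.Perm (Fin (n + 1))} {x : N} (i : Fin n)
    (h : Asc f (w * adjSwap i) x) (hi : w i.succ < w i.castSucc) : Asc f w (x * f i) := by
  have := h.step i (by simpa using hi)
  rwa [mul_assoc, adjSwap_mul_self, mul_one] at this

theorem Asc.cases' {w : Equiv.Perm (Fin (n + 1))} {x : N} (h : Asc f w x) :
    (w = 1 ∧ x = 1) ∨ ∃ i y, w i.succ < w i.castSucc ∧ x = y * f i ∧ Asc f (w * adjSwap i) y := by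
  cases h with
  | one => exact Or.inl ⟨rfl, rfl⟩
  | step i h hi =>
    refine Or.inr ⟨i, _, by simpa using hi, rfl, ?_⟩
    rwa [mul_assoc, adjSwap_mul_self, mul_one]

/-- The first place that changes is `i`, and its value drops. Removing descents is thus well-founded
before any length function exists. -/
theorem toLex_mul_adjSwap_lt {w : Equiv.Perm (Fin (n + 1))} {i : Fin n}
    (hi : w i.succ < w i.castSucc) :
    toLex (⇑(w * adjSwap i)) < toLex (⇑w) := by
  refine ⟨i.castSucc, fun j hj => ?_, ?_⟩
  · have hj' : (j : ℕ) < i := hj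
    simp [adjSwap_of_ne (i := i) (x := j) (by omega) (by omega)]
  · simpa using hi

theorem perm_induction {P : Equiv.Perm (Fin (n + 1)) → Prop}
    (h : ∀ w, (∀ i : Fin n, w i.succ < w i.castSucc → P (w * adjSwap i)) → P w)
    (w : Equiv.Perm (Fin (n + 1))) : P w := by
  have wf : WellFounded (fun v w : Equiv.Perm (Fin (n + 1)) => toLex (⇑v) < toLex (⇑w)) :=
    InvImage.wf (fun w : Equiv.Perm (Fin (n + 1)) => toLex (⇑w))
      (wellFounded_lt (α := Lex (Fin (n + 1) → Fin (n + 1))))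
  induction w using wf.induction with
  | _ w ih => exact h w fun i hi => ih _ (toLex_mul_adjSwap_lt hi)

theorem eq_one_of_forall_lt {w : Equiv.Perm (Fin (n + 1))}
    (h : ∀ i : Fin n, w i.castSucc < w i.succ) : w = 1 := by
  have hw : StrictMono w := Fin.strictMono_iff_lt_succ.2 h
  ext x
  have := (Equiv.Perm.monotone_iff w).1 hw.monotone
  simp [this]

variable (f) in
theorem exists_asc (w : Equiv.Perm (Fin (n + 1))) : ∃ x, Asc f w x := by
  induction w using perm_induction with
  | _ w ih =>
    by_cases h : ∃ i : Fin n, w i.succ < w i.castSucc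
    · obtain ⟨i, hi⟩ := h
      obtain ⟨x, hx⟩ := ih i hi
      exact ⟨_, hx.step' i hi⟩
    · push Not at h
      have : w = 1 := eq_one_of_forall_lt fun i => lt_of_le_of_ne (h i) fun he => by
        have := w.injective he
        simp [Fin.ext_iff] at this
      exact ⟨1, this ▸ Asc.one⟩

theorem mul_adjSwap_of_ne {w : Equiv.Perm (Fin (n + 1))} {i : Fin n} {x : Fin (n + 1)}
    (h1 : (x : ℕ) ≠ i) (h2 : (x : ℕ) ≠ i + 1) : (w * adjSwap i) x = w x := by
  rw [Equiv.Perm.mul_apply, adjSwap_of_ne h1 h2]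

/-- Any ascending factorization of the common lower permutation extends along both sides of the
diamond; none of `w` itself has to be given. -/
theorem asc_diamond_far (hf : BraidFamily f) {w : Equiv.Perm (Fin (n + 1))} {i j : Fin n}
    (hij : (i : ℕ) + 1 < j) (hi : w i.succ < w i.castSucc) (hj : w j.succ < w j.castSucc) :
    ∃ a b, Asc f (w * adjSwap i) a ∧ Asc f (w * adjSwap j) b ∧ a * f i = b * f j := by
  obtain ⟨x, hx⟩ := exists_asc f (w * adjSwap i * adjSwap j)
  refine ⟨x * f j, x * f i, hx.step' j ?_, Asc.step' i ?_ ?_, ?_⟩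
  · rwa [mul_adjSwap_of_ne (by simp; omega) (by simp; omega),
      mul_adjSwap_of_ne (by simp; omega) (by simp; omega)]
  · rwa [mul_assoc, ← (braidFamily_adjSwap n).comm i j hij, ← mul_assoc]
  · rwa [mul_adjSwap_of_ne (by simp; omega) (by simp; omega),
      mul_adjSwap_of_ne (by simp; omega) (by simp; omega)]
  · rw [mul_assoc, mul_assoc, hf.comm i j hij]

theorem asc_diamond_adj (hf : BraidFamily f) {w : Equiv.Perm (Fin (n + 1))} {i j : Fin n}
    (hij : (i : ℕ) + 1 = j) (hi : w i.succ < w i.castSucc) (hj : w j.succ < w j.castSucc) :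
    ∃ a b, Asc f (w * adjSwap i) a ∧ Asc f (w * adjSwap j) b ∧ a * f i = b * f j := by
  obtain ⟨x, hx⟩ := exists_asc f (w * adjSwap i * adjSwap j * adjSwap i)
  have e : i.succ = j.castSucc := Fin.ext hij
  have e1 : adjSwap i j.succ = j.succ := adjSwap_of_ne (by simp; omega) (by simp; omega)
  have e2 : adjSwap j i.castSucc = i.castSucc := adjSwap_of_ne (by simp; omega) (by simp; omega)
  have e3 : adjSwap i j.castSucc = i.castSucc := e ▸ adjSwap_succ i
  have e4 : adjSwap j i.succ = j.succ := e ▸ adjSwap_castSucc j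
  have hw : w * adjSwap i * adjSwap j * adjSwap i = w * adjSwap j * adjSwap i * adjSwap j := by
    simpa only [mul_assoc] using congrArg (w * ·) ((braidFamily_adjSwap n).braid i j hij)
  rw [e] at hi
  rw [e] at e4
  refine ⟨x * f i * f j, x * f j * f i, Asc.step' j (Asc.step' i hx ?_) ?_,
    Asc.step' i (Asc.step' j (hw ▸ hx) ?_) ?_, ?_⟩
  · simpa [Equiv.Perm.mul_apply, e, e1, e2, e3, e4] using hj
  · simpa [Equiv.Perm.mul_apply, e, e1, e2, e3, e4] using hj.trans hi
  · simpa [Equiv.Perm.mul_apply, e, e1, e2, e3, e4] using hi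
  · simpa [Equiv.Perm.mul_apply, e, e1, e2, e3, e4] using hj.trans hi
  · simpa only [mul_assoc] using congrArg (x * ·) (hf.braid i j hij)

/-- Matsumoto's theorem for the symmetric group. -/
theorem Asc.unique (hf : BraidFamily f) {w : Equiv.Perm (Fin (n + 1))} {x y : N}
    (hx : Asc f w x) (hy : Asc f w y) : x = y := by
  induction w using perm_induction generalizing x y with
  | _ w ih =>
    rcases hx.cases' with ⟨rfl, rfl⟩ | ⟨i, x', hi, rfl, hx'⟩
    · rcases hy.cases' with ⟨-, rfl⟩ | ⟨j, y', hj, rfl, hy'⟩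
      · rfl
      · exact absurd hj (by simp [Fin.lt_def])
    · rcases hy.cases' with ⟨rfl, rfl⟩ | ⟨j, y', hj, rfl, hy'⟩
      · exact absurd hi (by simp [Fin.lt_def])
      · rcases lt_trichotomy i j with h | rfl | h
        -- By induction the given shorter factorizations may be replaced by those of the diamond,
        -- whose extensions agree.
        · obtain ⟨a, b, ha, hb, hab⟩ : ∃ a b, Asc f (w * adjSwap i) a ∧ Asc f (w * adjSwap j) b ∧
              a * f i = b * f j := by
            rcases Nat.lt_or_ge ((i : ℕ) + 1) j with h2 | h2
            · exact asc_diamond_far hf h2 hi hj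
            · exact asc_diamond_adj hf (le_antisymm h h2) hi hj
          rw [ih i hi hx' ha, ih j hj hy' hb, hab]
        · rw [ih i hi hx' hy']
        · obtain ⟨a, b, ha, hb, hab⟩ : ∃ a b, Asc f (w * adjSwap j) a ∧ Asc f (w * adjSwap i) b ∧
              a * f j = b * f i := by
            rcases Nat.lt_or_ge ((j : ℕ) + 1) i with h2 | h2
            · exact asc_diamond_far hf h2 hj hi
            · exact asc_diamond_adj hf (le_antisymm h h2) hj hi
          rw [ih j hj hy' ha, ih i hi hx' hb, hab]

variable (f) in
/-- The product of `f` along a reduced word of the permutation `w`. -/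
noncomputable def reducedProd (w : Equiv.Perm (Fin (n + 1))) : N := (exists_asc f w).choose

variable (f) in
theorem asc_reducedProd (w : Equiv.Perm (Fin (n + 1))) : Asc f w (reducedProd f w) :=
  (exists_asc f w).choose_spec

theorem reducedProd_one (hf : BraidFamily f) : reducedProd f 1 = 1 :=
  (asc_reducedProd f 1).unique hf Asc.one

theorem reducedProd_mul_of_lt (hf : BraidFamily f) {w : Equiv.Perm (Fin (n + 1))} {i : Fin n}
    (h : w i.castSucc < w i.succ) :
    reducedProd f (w * adjSwap i) = reducedProd f w * f i :=
  (asc_reducedProd f _).unique hf ((asc_reducedProd f w).step i h)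

theorem reducedProd_mul_of_gt (hf : BraidFamily f) {w : Equiv.Perm (Fin (n + 1))} {i : Fin n}
    (h : w i.succ < w i.castSucc) :
    reducedProd f (w * adjSwap i) * f i = reducedProd f w :=
  ((asc_reducedProd f _).step' i h).unique hf (asc_reducedProd f w)

theorem lt_or_gt_succ (w : Equiv.Perm (Fin (n + 1))) (i : Fin n) :
    w i.castSucc < w i.succ ∨ w i.succ < w i.castSucc :=
  lt_or_gt_of_ne fun he => by
    have := w.injective he
    simp [Fin.ext_iff] at this

end Asc

/-! ### The Coxeter group of type `A` -/

section Group

variable {n : ℕ}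

theorem exists_toPerm (n : ℕ) : ∃ p : (CoxeterMatrix.A n).Group →* Equiv.Perm (Fin (n + 1)),
    ∀ i, p ((CoxeterMatrix.A n).simple i) = adjSwap i := by
  have key : (CoxeterMatrix.A n).IsLiftable (adjSwap (n := n)) := by
    have h2 : ∀ i j : Fin n, (i : ℕ) + 1 < j → (adjSwap i * adjSwap j) ^ 2 = 1 := by
      intro i j h
      rw [pow_two]
      nth_rw 2 [(braidFamily_adjSwap n).comm i j h]
      rw [mul_assoc, ← mul_assoc (adjSwap j), adjSwap_mul_self, one_mul, adjSwap_mul_self]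
    have h3 : ∀ i j : Fin n, (i : ℕ) + 1 = j → (adjSwap i * adjSwap j) ^ 3 = 1 := by
      intro i j h
      have e := (braidFamily_adjSwap n).braid i j h
      calc (adjSwap i * adjSwap j) ^ 3
          = (adjSwap i * adjSwap j * adjSwap i) * (adjSwap j * adjSwap i * adjSwap j) := by
            simp only [pow_succ, pow_zero, one_mul, mul_assoc]
        _ = (adjSwap i * adjSwap j * adjSwap i) * (adjSwap i * adjSwap j * adjSwap i) := by rw [e]
        _ = adjSwap i * (adjSwap j * (adjSwap i * adjSwap i) * adjSwap j) * adjSwap i := by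
            simp only [mul_assoc]
        _ = 1 := by simp
    intro i j
    rcases lt_trichotomy i j with h | rfl | h
    · have h' : (i : ℕ) < j := h
      rcases Nat.lt_or_ge ((i : ℕ) + 1) j with h4 | h4
      · rw [A_far h4, h2 i j h4]
      · rw [A_adj (le_antisymm h h4), h3 i j (le_antisymm h h4)]
    · simp
    · have inv : ∀ m, (adjSwap j * adjSwap i) ^ m = 1 → (adjSwap i * adjSwap j) ^ m = 1 := by
        intro m hm
        have : adjSwap i * adjSwap j = (adjSwap j * adjSwap i)⁻¹ := by
          rw [mul_inv_rev, eq_comm]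
          congr 1
        rw [this, inv_pow, hm, inv_one]
      rw [(CoxeterMatrix.A n).symmetric i j]
      apply inv
      rcases Nat.lt_or_ge ((j : ℕ) + 1) i with h4 | h4
      · rw [A_far h4, h2 j i h4]
      · rw [A_adj (le_antisymm h h4), h3 j i (le_antisymm h h4)]
  exact ⟨(CoxeterMatrix.A n).toCoxeterSystem.lift ⟨_, key⟩, fun i =>
    CoxeterSystem.lift_apply_simple _ key i⟩

/-- The homomorphism from the Coxeter group of type `A_n` to the symmetric group. -/
noncomputable def toPerm (n : ℕ) : (CoxeterMatrix.A n).Group →* Equiv.Perm (Fin (n + 1)) :=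
  (exists_toPerm n).choose

@[simp] theorem toPerm_simple (i : Fin n) :
    toPerm n ((CoxeterMatrix.A n).simple i) = adjSwap i :=
  (exists_toPerm n).choose_spec i

theorem simple_mul_self (i : Fin n) :
    (CoxeterMatrix.A n).simple i * (CoxeterMatrix.A n).simple i = 1 :=
  (CoxeterMatrix.A n).toCoxeterSystem.simple_mul_simple_self i

theorem reducedProd_simple_mul (w : Equiv.Perm (Fin (n + 1))) (i : Fin n) :
    reducedProd (CoxeterMatrix.A n).simple (w * adjSwap i) =
      reducedProd (CoxeterMatrix.A n).simple w * (CoxeterMatrix.A n).simple i := by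
  rcases lt_or_gt_succ w i with h | h
  · exact reducedProd_mul_of_lt (braidFamily_simple n) h
  · rw [← reducedProd_mul_of_gt (braidFamily_simple n) h, mul_assoc, simple_mul_self, mul_one]

/-- In the group the multiplication rule holds at descents as well, since generators are
involutions. So `reducedProd` gives a left inverse of `toPerm`. -/
theorem reducedProd_toPerm (g : (CoxeterMatrix.A n).Group) :
    reducedProd (CoxeterMatrix.A n).simple (toPerm n g) = g := by
  induction g using (CoxeterMatrix.A n).toCoxeterSystem.simple_induction_right with
  | one => rw [map_one, reducedProd_one (braidFamily_simple n)]
  | mul_simple_right g i ih =>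
    rw [CoxeterMatrix.toCoxeterSystem_simple, map_mul, toPerm_simple, reducedProd_simple_mul, ih]

theorem toPerm_injective (n : ℕ) : Function.Injective (toPerm n) :=
  Function.LeftInverse.injective reducedProd_toPerm

instance : Finite (CoxeterMatrix.A n).Group := Finite.of_injective _ (toPerm_injective n)

/-- The Coxeter length of a permutation. -/
noncomputable def permLength (w : Equiv.Perm (Fin (n + 1))) : ℕ :=
  (reducedProd (fun _ : Fin n => Multiplicative.ofAdd 1) w).toAdd

theorem braidFamily_const : BraidFamily (fun _ : Fin n => Multiplicative.ofAdd (1 : ℕ)) :=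
  ⟨fun _ _ _ => rfl, fun _ _ _ => rfl⟩

theorem permLength_one : permLength (1 : Equiv.Perm (Fin (n + 1))) = 0 := by
  rw [permLength, reducedProd_one braidFamily_const]; rfl

theorem permLength_mul_of_lt {w : Equiv.Perm (Fin (n + 1))} {i : Fin n}
    (h : w i.castSucc < w i.succ) : permLength (w * adjSwap i) = permLength w + 1 := by
  rw [permLength, reducedProd_mul_of_lt braidFamily_const h]; rfl

theorem permLength_mul_of_gt {w : Equiv.Perm (Fin (n + 1))} {i : Fin n}
    (h : w i.succ < w i.castSucc) : permLength (w * adjSwap i) + 1 = permLength w := by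
  conv_rhs => rw [permLength, ← reducedProd_mul_of_gt braidFamily_const h]
  rfl

/-- Each letter changes `permLength` by ±1. Equality with the word length forces every letter to
ascend, so the word is an ascending factorization. This makes the choice in `ofGroup` harmless. -/
theorem word_permLength (l : List (Fin n)) :
    permLength (toPerm n ((CoxeterMatrix.A n).toCoxeterSystem.wordProd l)) ≤ l.length ∧
      (permLength (toPerm n ((CoxeterMatrix.A n).toCoxeterSystem.wordProd l)) = l.length →
        (l.map (gen (CoxeterMatrix.A n))).prod = reducedProd (gen (CoxeterMatrix.A n))
          (toPerm n ((CoxeterMatrix.A n).toCoxeterSystem.wordProd l))) := by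
  induction l using List.reverseRecOn with
  | nil => simp [permLength_one, reducedProd_one (braidFamily_gen n)]
  | append_singleton l i ih =>
    obtain ⟨ih1, ih2⟩ := ih
    rw [CoxeterSystem.wordProd_append, CoxeterSystem.wordProd_singleton,
      CoxeterMatrix.toCoxeterSystem_simple, map_mul, toPerm_simple]
    rcases lt_or_gt_succ (toPerm n ((CoxeterMatrix.A n).toCoxeterSystem.wordProd l)) i with h | h
    · rw [permLength_mul_of_lt h, reducedProd_mul_of_lt (braidFamily_gen n) h]
      simp only [List.length_append, List.length_singleton, List.map_append, List.map_singleton,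
        List.prod_append, List.prod_singleton]
      exact ⟨by omega, fun h => by rw [ih2 (by omega)]⟩
    · have := permLength_mul_of_gt h
      simp only [List.length_append, List.length_singleton]
      exact ⟨by omega, fun h => by omega⟩

theorem length_eq_permLength (g : (CoxeterMatrix.A n).Group) :
    (CoxeterMatrix.A n).toCoxeterSystem.length g = permLength (toPerm n g) := by
  apply le_antisymm
  · have key : ∀ w : Equiv.Perm (Fin (n + 1)), (CoxeterMatrix.A n).toCoxeterSystem.length
        (reducedProd (CoxeterMatrix.A n).simple w) ≤ permLength w := by
      intro w
      induction w using perm_induction with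
      | _ w ih =>
        by_cases h : ∃ i : Fin n, w i.succ < w i.castSucc
        · obtain ⟨i, hi⟩ := h
          rw [← reducedProd_mul_of_gt (braidFamily_simple n) hi, ← permLength_mul_of_gt hi]
          refine ((CoxeterMatrix.A n).toCoxeterSystem.length_mul_le _ _).trans ?_
          rw [← CoxeterMatrix.toCoxeterSystem_simple, CoxeterSystem.length_simple]
          exact Nat.add_le_add_right (ih i hi) 1
        · have : w = 1 := eq_one_of_forall_lt fun i =>
            (lt_or_gt_succ w i).resolve_right fun hi => h ⟨i, hi⟩
          rw [this, reducedProd_one (braidFamily_simple n), CoxeterSystem.length_one]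
          exact Nat.zero_le _
    simpa only [reducedProd_toPerm] using key (toPerm n g)
  · obtain ⟨l, hl, rfl⟩ := (CoxeterMatrix.A n).toCoxeterSystem.exists_isReduced g
    rw [hl.eq]
    exact (word_permLength l).1

theorem ofGroup_eq (g : (CoxeterMatrix.A n).Group) :
    ofGroup g = reducedProd (gen (CoxeterMatrix.A n)) (toPerm n g) := by
  obtain ⟨h1, h2⟩ := ((CoxeterMatrix.A n).toCoxeterSystem.exists_isReduced g).choose_spec
  have h3 := h1.eq
  rw [length_eq_permLength] at h3
  have := (word_permLength _).2 h3
  rw [← h2] at this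
  exact this

theorem isLongest_longest (J : Set (Fin n)) :
    IsLongest (CoxeterMatrix.A n) J (longest (CoxeterMatrix.A n) J) := by
  have h : ∃ w, IsLongest (CoxeterMatrix.A n) J w := by
    obtain ⟨w, hw⟩ := Finite.exists_max fun w : parabolicSubgroup (CoxeterMatrix.A n) J =>
      (CoxeterMatrix.A n).toCoxeterSystem.length (w : (CoxeterMatrix.A n).Group)
    exact ⟨w, w.2, fun v hv => hw ⟨v, hv⟩⟩
  rw [longest, dif_pos h]
  exact h.choose_spec

end Group

/-! ### The action on height functions -/

/-- Functions on `ℕ` all of whose steps are `0` or `1`. -/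
def Height : Type := {c : ℕ → ℕ // ∀ i, c i ≤ c (i + 1) ∧ c (i + 1) ≤ c i + 1}

instance : CoeFun Height (fun _ => ℕ → ℕ) := ⟨Subtype.val⟩

namespace Height

@[ext] theorem ext {c d : Height} (h : ∀ i, c i = d i) : c = d := Subtype.ext (funext h)

theorem mono (c : Height) {i j : ℕ} (h : i ≤ j) : c i ≤ c j :=
  monotone_nat_of_le_succ (fun i => (c.2 i).1) h

theorem le_add (c : Height) {i j : ℕ} (h : i ≤ j) : c j ≤ c i + (j - i) := by
  induction j, h using Nat.le_induction with
  | base => simp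
  | succ j h ih => have := (c.2 j).2; omega

/-- Replace the value at `i + 1` by the largest value allowed by the neighbours. -/
def sort (i : ℕ) (c : Height) : Height :=
  ⟨fun j => if j = i + 1 then min (c i + 1) (c (i + 2)) else c j, fun j => by
    have h1 := c.2 j
    have h2 := c.2 i
    have h3 : c (i + 1) ≤ c (i + 2) ∧ c (i + 2) ≤ c (i + 1) + 1 := c.2 (i + 1)
    rcases eq_or_ne j i with rfl | h
    · simp; omega
    · rcases eq_or_ne j (i + 1) with rfl | h'
      · simp; omega
      · simpa [h, h'] using h1⟩

theorem sort_apply (i : ℕ) (c : Height) (j : ℕ) :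
    sort i c j = if j = i + 1 then min (c i + 1) (c (i + 2)) else c j := rfl

theorem sort_self (i : ℕ) (c : Height) : sort i c (i + 1) = min (c i + 1) (c (i + 2)) := by
  simp [sort_apply]

theorem sort_of_ne {i j : ℕ} (c : Height) (h : j ≠ i + 1) : sort i c j = c j := by
  simp [sort_apply, h]

theorem sort_sort (i : ℕ) (c : Height) : sort i (sort i c) = sort i c := by
  ext j
  rcases eq_or_ne j (i + 1) with rfl | h
  · simp [sort_apply]
  · simp [sort_apply, h]

theorem sort_comm {i j : ℕ} (h : i + 1 < j) (c : Height) :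
    sort i (sort j c) = sort j (sort i c) := by
  ext k
  simp only [sort_apply]
  split_ifs <;> first | rfl | omega

/-- Both sides completely sort the three letters `i`, `i + 1`, `i + 2`. -/
theorem sort_braid (i : ℕ) (c : Height) :
    sort i (sort (i + 1) (sort i c)) = sort (i + 1) (sort i (sort (i + 1) c)) := by
  ext k
  have h1 := c.2 i
  have h2 : c (i + 1) ≤ c (i + 2) ∧ c (i + 2) ≤ c (i + 1) + 1 := c.2 (i + 1)
  have h3 : c (i + 2) ≤ c (i + 3) ∧ c (i + 3) ≤ c (i + 2) + 1 := c.2 (i + 2)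
  have e1 : i + 1 + 2 = i + 3 := rfl
  have e2 : i + 1 + 1 = i + 2 := rfl
  rcases eq_or_ne k (i + 1) with rfl | h4
  · simp [sort_apply, e1, e2]; omega
  rcases eq_or_ne k (i + 2) with rfl | h5
  · simp [sort_apply, e1, e2]; omega
  · simp [sort_apply, h4, h5]

end Height

variable {n : ℕ}

theorem exists_act (n : ℕ) : ∃ φ : Hecke (CoxeterMatrix.A n) →* (Function.End Height)ᵐᵒᵖ,
    ∀ i : Fin n, φ (gen (CoxeterMatrix.A n) i) = MulOpposite.op (Height.sort i) := by
  apply exists_heckeHom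
  · constructor
    · intro i j h
      exact congrArg MulOpposite.op (funext fun c => (Height.sort_comm h c).symm)
    · intro i j h
      rw [← h]
      exact congrArg MulOpposite.op (funext fun c => Height.sort_braid i c)
  · intro i
    exact congrArg MulOpposite.op (funext fun c => Height.sort_sort i c)

/-- The right action of the Hecke monoid of type `A_n` on height functions. -/
noncomputable def act (c : Height) (x : Hecke (CoxeterMatrix.A n)) : Height :=
  ((exists_act n).choose x).unop c

@[simp] theorem act_one (c : Height) : act c (1 : Hecke (CoxeterMatrix.A n)) = c := by
  simp only [act, map_one]; rfl

@[simp] theorem act_mul (c : Height) (x y : Hecke (CoxeterMatrix.A n)) :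
    act c (x * y) = act (act c x) y := by
  simp only [act, map_mul]; rfl

@[simp] theorem act_gen (c : Height) (i : Fin n) :
    act c (gen (CoxeterMatrix.A n) i) = Height.sort i c := by
  simp only [act, (exists_act n).choose_spec]; rfl

theorem hecke_induction {B : Type*} {M : CoxeterMatrix B} {P : Hecke M → Prop} (one : P 1)
    (mul : ∀ x i, P x → P (x * gen M i)) (x : Hecke M) : P x := by
  obtain ⟨l, rfl⟩ := exists_word x
  induction l using List.reverseRecOn with
  | nil => exact one
  | append_singleton l i ih => simpa using mul _ i ih

/-- Sorting sets a height to the largest admissible value. This monotonicity drives the squeeze in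
`absorbs_of_idem`. -/
theorem le_act (c : Height) (x : Hecke (CoxeterMatrix.A n)) (k : ℕ) : c k ≤ act c x k := by
  induction x using hecke_induction generalizing k with
  | one => simp
  | mul x i ih =>
    rw [act_mul, act_gen]
    refine (ih k).trans ?_
    rcases eq_or_ne k (i + 1) with rfl | h
    · rw [Height.sort_self]
      exact le_min ((act c x).2 _).2 ((act c x).2 _).1
    · rw [Height.sort_of_ne _ h]

theorem act_mono {c d : Height} (h : ∀ k, c k ≤ d k) (x : Hecke (CoxeterMatrix.A n)) (k : ℕ) :
    act c x k ≤ act d x k := by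
  induction x using hecke_induction generalizing k with
  | one => simpa using h k
  | mul x i ih =>
    rw [act_mul, act_gen, act_mul, act_gen]
    rcases eq_or_ne k (i + 1) with rfl | h
    · rw [Height.sort_self, Height.sort_self]
      exact min_le_min (Nat.add_le_add_right (ih _) 1) (ih _)
    · rw [Height.sort_of_ne _ h, Height.sort_of_ne _ h]
      exact ih k

/-- `count t w i` is the number of points `x < i` with `w x ≥ t`. -/
def count (t : ℕ) (w : Equiv.Perm (Fin (n + 1))) : Height :=
  -- Places beyond `n` carry the letter 0, so heights are defined on all of `ℕ`.
  ⟨fun i => ∑ k ∈ Finset.range i, if ∃ h : k < n + 1, t ≤ w ⟨k, h⟩ then 1 else 0, fun i => by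
    simp only [Finset.sum_range_succ]
    split_ifs <;> omega⟩

@[simp] theorem count_zero (t : ℕ) (w : Equiv.Perm (Fin (n + 1))) : count t w 0 = 0 := rfl

theorem count_succ (t : ℕ) (w : Equiv.Perm (Fin (n + 1))) (i : ℕ) :
    count t w (i + 1) = count t w i + if ∃ h : i < n + 1, t ≤ w ⟨i, h⟩ then 1 else 0 :=
  Finset.sum_range_succ _ _

theorem count_succ_val (t : ℕ) (w : Equiv.Perm (Fin (n + 1))) (x : Fin (n + 1)) :
    count t w (x + 1) = count t w x + if t ≤ w x then 1 else 0 := by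
  simp [count_succ, Nat.lt_succ_iff.1 x.2]

theorem count_mul_adjSwap_of_le (t : ℕ) (w : Equiv.Perm (Fin (n + 1))) (i : Fin n) {k : ℕ}
    (hk : k ≤ i) : count t (w * adjSwap i) k = count t w k := by
  induction k with
  | zero => rfl
  | succ k ih =>
    have hk' : k < n + 1 := by omega
    have := mul_adjSwap_of_ne (w := w) (i := i) (x := ⟨k, hk'⟩) (by simp; omega) (by simp; omega)
    simp [count_succ, ih (by omega), hk', -Equiv.Perm.coe_mul, this]

theorem count_mul_adjSwap_succ (t : ℕ) (w : Equiv.Perm (Fin (n + 1))) (i : Fin n) :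
    count t (w * adjSwap i) (i + 1) = count t w i + if t ≤ w i.succ then 1 else 0 := by
  have := count_succ_val t (w * adjSwap i) i.castSucc
  simp only [Fin.val_castSucc, Equiv.Perm.mul_apply, adjSwap_castSucc] at this
  rw [this, count_mul_adjSwap_of_le t w i le_rfl]

theorem count_castSucc (t : ℕ) (w : Equiv.Perm (Fin (n + 1))) (i : Fin n) :
    count t w (i + 1) = count t w i + if t ≤ w i.castSucc then 1 else 0 :=
  count_succ_val t w i.castSucc

theorem count_two (t : ℕ) (w : Equiv.Perm (Fin (n + 1))) (i : Fin n) :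
    count t w (i + 2) = count t w i + (if t ≤ w i.castSucc then 1 else 0) +
      if t ≤ w i.succ then 1 else 0 := by
  rw [← count_castSucc]
  exact count_succ_val t w i.succ

theorem count_mul_adjSwap_of_ge (t : ℕ) (w : Equiv.Perm (Fin (n + 1))) (i : Fin n) {k : ℕ}
    (hk : i + 2 ≤ k) : count t (w * adjSwap i) k = count t w k := by
  induction k, hk using Nat.le_induction with
  | base =>
    rw [count_two, count_two, count_mul_adjSwap_of_le t w i le_rfl]
    simp only [Equiv.Perm.mul_apply, adjSwap_castSucc, adjSwap_succ]
    omega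
  | succ k hk ih =>
    rw [count_succ, count_succ, ih]
    have : ∀ h : k < n + 1, (w * adjSwap i) ⟨k, h⟩ = w ⟨k, h⟩ := fun h =>
      mul_adjSwap_of_ne (by simp; omega) (by simp; omega)
    simp only [this]

/-- At an ascent the two letters are 00, 01 or 11 for every threshold, and on these swapping is the
same as sorting. -/
theorem count_mul_adjSwap_of_lt (t : ℕ) {w : Equiv.Perm (Fin (n + 1))} {i : Fin n}
    (h : w i.castSucc < w i.succ) :
    count t (w * adjSwap i) = Height.sort i (count t w) := by
  ext k
  rcases lt_trichotomy k (i + 1) with hk | rfl | hk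
  · rw [Height.sort_of_ne _ hk.ne, count_mul_adjSwap_of_le t w i (by omega)]
  · rw [Height.sort_self, count_mul_adjSwap_succ, count_two]
    have h' : (w i.castSucc : ℕ) < w i.succ := h
    split_ifs <;> omega
  · rw [Height.sort_of_ne _ hk.ne', count_mul_adjSwap_of_ge t w i (by omega)]

/-- The Hecke monoid element attached to a permutation. -/
noncomputable abbrev ofPerm (w : Equiv.Perm (Fin (n + 1))) : Hecke (CoxeterMatrix.A n) :=
  reducedProd (gen (CoxeterMatrix.A n)) w

theorem act_ofPerm (t : ℕ) (w : Equiv.Perm (Fin (n + 1))) :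
    act (count t (1 : Equiv.Perm (Fin (n + 1)))) (ofPerm w) = count t w := by
  have := asc_reducedProd (gen (CoxeterMatrix.A n)) w
  change act _ (reducedProd _ w) = _
  generalize reducedProd (gen (CoxeterMatrix.A n)) w = x at this ⊢
  induction this with
  | one => simp
  | step i _ h ih => rw [act_mul, ih, act_gen, count_mul_adjSwap_of_lt t h]

theorem count_injective {w v : Equiv.Perm (Fin (n + 1))} (h : ∀ t, count t w = count t v) :
    w = v := by
  ext x
  have key : ∀ t : ℕ, t ≤ w x ↔ t ≤ v x := fun t => by
    have h1 := count_succ_val t w x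
    have h2 := count_succ_val t v x
    rw [h t] at h1
    by_cases h3 : t ≤ w x <;> by_cases h4 : t ≤ v x <;> simp [h3, h4] at h1 h2 ⊢ <;> omega
  exact le_antisymm ((key _).1 le_rfl) ((key _).2 le_rfl)

theorem ofPerm_injective : Function.Injective (ofPerm (n := n)) := fun w v h =>
  count_injective fun t => by rw [← act_ofPerm, h, act_ofPerm]

theorem ofPerm_mul_gen_of_lt {w : Equiv.Perm (Fin (n + 1))} {i : Fin n}
    (h : w i.castSucc < w i.succ) :
    ofPerm w * gen (CoxeterMatrix.A n) i = ofPerm (w * adjSwap i) :=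
  (reducedProd_mul_of_lt (braidFamily_gen n) h).symm

theorem ofPerm_mul_gen_of_gt {w : Equiv.Perm (Fin (n + 1))} {i : Fin n}
    (h : w i.succ < w i.castSucc) : ofPerm w * gen (CoxeterMatrix.A n) i = ofPerm w := by
  change reducedProd _ w * _ = reducedProd _ w
  rw [← reducedProd_mul_of_gt (braidFamily_gen n) h, mul_assoc, gen_idem]

theorem ofPerm_surjective : Function.Surjective (ofPerm (n := n)) := fun x => by
  induction x using hecke_induction with
  | one => exact ⟨1, reducedProd_one (braidFamily_gen n)⟩
  | mul x i ih =>
    obtain ⟨w, rfl⟩ := ih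
    rcases lt_or_gt_succ w i with h | h
    · exact ⟨_, (ofPerm_mul_gen_of_lt h).symm⟩
    · exact ⟨w, (ofPerm_mul_gen_of_gt h).symm⟩

/-- Faithfulness: the heights reached from those of the identity already determine the permutation.
-/
theorem hecke_ext {x y : Hecke (CoxeterMatrix.A n)} (h : ∀ c k, act c x k = act c y k) :
    x = y := by
  obtain ⟨w, rfl⟩ := ofPerm_surjective x
  obtain ⟨v, rfl⟩ := ofPerm_surjective y
  congr 1
  refine count_injective fun t => ?_
  rw [← act_ofPerm t w, ← act_ofPerm t v]
  exact Height.ext (h _)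

/-- The height function of the identity. -/
def base (n t : ℕ) : Height :=
  -- For `t ≤ n + 1` this is the word with `t` zeros followed by `n + 1 - t` ones; truncated
  -- subtraction produces the zeros.
  ⟨fun i => min i (n + 1) - t, fun i => by dsimp only; omega⟩

theorem base_apply (n t i : ℕ) : base n t i = min i (n + 1) - t := rfl

theorem count_one (t : ℕ) : count t (1 : Equiv.Perm (Fin (n + 1))) = base n t := by
  ext i
  induction i with
  | zero => simp [base_apply]
  | succ i ih =>
    simp only [count_succ, ih, base_apply, Equiv.Perm.coe_one, id, exists_prop]
    split_ifs <;> omega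

/-! ### Absorbing elements of parabolic submonoids -/

theorem act_of_notMem {J : Set (Fin n)} {x : Hecke (CoxeterMatrix.A n)}
    (hx : x ∈ parabolicSubmonoid (CoxeterMatrix.A n) J) (c : Height) {k : ℕ}
    (hk : ∀ j ∈ J, k ≠ (j : ℕ) + 1) : act c x k = c k := by
  induction hx using Submonoid.closure_induction_right with
  | one => simp
  | mul_right x hx y hy ih =>
    obtain ⟨j, hj, rfl⟩ := hy
    rw [act_mul, act_gen, Height.sort_of_ne _ (hk j hj), ih]

/-- `x` is the zero element of the parabolic submonoid of `J`. -/
structure Absorbs (J : Set (Fin n)) (x : Hecke (CoxeterMatrix.A n)) : Prop where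
  mem : x ∈ parabolicSubmonoid (CoxeterMatrix.A n) J
  mul_gen : ∀ j ∈ J, x * gen (CoxeterMatrix.A n) j = x

theorem Absorbs.mul_of_mem {J : Set (Fin n)} {x y : Hecke (CoxeterMatrix.A n)} (hx : Absorbs J x)
    (hy : y ∈ parabolicSubmonoid (CoxeterMatrix.A n) J) : x * y = x := by
  induction hy using Submonoid.closure_induction_right with
  | one => simp
  | mul_right y _ z hz ih =>
    obtain ⟨j, hj, rfl⟩ := hz
    rw [← mul_assoc, ih, hx.mul_gen j hj]

theorem Absorbs.mul_self {J : Set (Fin n)} {x : Hecke (CoxeterMatrix.A n)} (hx : Absorbs J x) :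
    x * x = x := hx.mul_of_mem hx.mem

theorem parabolicSubmonoid_mono {B : Type*} (M : CoxeterMatrix B) {J K : Set B} (h : J ⊆ K) :
    parabolicSubmonoid M J ≤ parabolicSubmonoid M K :=
  Submonoid.closure_mono (Set.image_mono h)

/-- Since x y = x, acting by x amounts to acting by y on an already raised function. A zero element
thus acts as the maximum, whence its uniqueness. -/
theorem Absorbs.act_le {J : Set (Fin n)} {x y : Hecke (CoxeterMatrix.A n)} (hx : Absorbs J x)
    (hy : y ∈ parabolicSubmonoid (CoxeterMatrix.A n) J) (c : Height) (k : ℕ) :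
    act c y k ≤ act c x k := by
  rw [← hx.mul_of_mem hy, act_mul]
  exact act_mono (le_act c x) y k

theorem Absorbs.unique {J : Set (Fin n)} {x y : Hecke (CoxeterMatrix.A n)} (hx : Absorbs J x)
    (hy : Absorbs J y) : x = y :=
  hecke_ext fun c k => le_antisymm (hy.act_le hx.mem c k) (hx.act_le hy.mem c k)

theorem Absorbs.mul_of_mem' {J : Set (Fin n)} {x y : Hecke (CoxeterMatrix.A n)}
    (hx : Absorbs J x) (hy : y ∈ parabolicSubmonoid (CoxeterMatrix.A n) J) : y * x = x :=
  Absorbs.unique ⟨mul_mem hy hx.mem, fun j hj => by rw [mul_assoc, hx.mul_gen j hj]⟩ hx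

/-- If `j ∉ J`, then x leaves height 0 at `j + 1` for the word whose first 1 is in place `j + 1`,
while the height at `j + 2` is positive; a further sort at `j` would raise it. -/
theorem mem_of_mul_gen_eq {J : Set (Fin n)} {x : Hecke (CoxeterMatrix.A n)} {j : Fin n}
    (hx : x ∈ parabolicSubmonoid (CoxeterMatrix.A n) J)
    (h : x * gen (CoxeterMatrix.A n) j = x) : j ∈ J := by
  by_contra hj
  have h1 : act (base n (j + 1)) x (j + 1) = base n (j + 1) (j + 1) :=
    act_of_notMem hx _ fun i hi e => hj (by rwa [show j = i from Fin.ext (by omega)])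
  have h2 := congrArg (fun y => act (base n (j + 1)) y (j + 1)) h
  simp only [act_mul, act_gen, Height.sort_self, h1] at h2
  have h3 := le_act (base n (j + 1)) x (j + 2)
  simp only [base_apply] at h2 h3
  omega

theorem Absorbs.supp_eq {J : Set (Fin n)} {x : Hecke (CoxeterMatrix.A n)} (hx : Absorbs J x) :
    supp x = J := by
  apply subset_antisymm
  · exact Set.iInter₂_subset J hx.mem
  · exact Set.subset_iInter₂ fun K hK j hj => mem_of_mul_gen_eq hK (hx.mul_gen j hj)

theorem absorbs_of_idem {x : Hecke (CoxeterMatrix.A n)} (h : x * x = x) : Absorbs (supp x) x := by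
  obtain ⟨J, hJ⟩ : ∃ J, Absorbs J x := by
    obtain ⟨l, hl⟩ := exists_word x
    refine ⟨{j | j ∈ l}, ?_, fun j hj => ?_⟩
    · rw [hl]
      apply Submonoid.list_prod_mem
      intro y hy
      obtain ⟨j, hj, rfl⟩ := List.mem_map.1 hy
      exact Submonoid.subset_closure ⟨j, hj, rfl⟩
    · obtain ⟨a, b, rfl⟩ := List.append_of_mem hj
      set u := (a.map (gen (CoxeterMatrix.A n))).prod
      set v := (b.map (gen (CoxeterMatrix.A n))).prod
      have hl' : x = u * gen (CoxeterMatrix.A n) j * v := by simpa [mul_assoc] using hl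
      -- Idempotence gives x·u·s_j·v = x. Heights only grow along the product, so x·u and x·u·s_j
      -- both equal x.
      have h1 : x * (u * gen (CoxeterMatrix.A n) j) * v = x := by
        rw [mul_assoc, ← hl', h]
      have h2 : x * u = x := hecke_ext fun c k => le_antisymm
        (by
          conv_rhs => rw [← h1]
          rw [← mul_assoc, act_mul _ _ v, act_mul _ _ (gen _ _)]
          exact (le_act _ _ _).trans (le_act _ _ _))
        (by rw [act_mul]; exact le_act _ _ _)
      refine hecke_ext fun c k => le_antisymm ?_ (by rw [act_mul]; exact le_act _ _ _)
      rw [← mul_assoc, h2] at h1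
      conv_rhs => rw [← h1]
      rw [act_mul _ _ v]
      exact le_act _ _ _
  rwa [hJ.supp_eq]

theorem absorbs_empty : Absorbs (∅ : Set (Fin n)) 1 := ⟨one_mem _, fun _ h => h.elim⟩

theorem absorbs_singleton (i : Fin n) : Absorbs {i} (gen (CoxeterMatrix.A n) i) :=
  ⟨Submonoid.subset_closure ⟨i, rfl, rfl⟩, by rintro _ rfl; exact gen_idem _ _⟩

/-! ### Longest elements of parabolic subgroups as absorbing elements -/

theorem ofPerm_mem {J : Set (Fin n)} {w : Equiv.Perm (Fin (n + 1))}
    (h : ∀ i ∉ J, ∀ x : Fin (n + 1), (x : ℕ) ≤ i ↔ (w x : ℕ) ≤ i) :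
    ofPerm w ∈ parabolicSubmonoid (CoxeterMatrix.A n) J := by
  have hw := asc_reducedProd (gen (CoxeterMatrix.A n)) w
  change reducedProd _ w ∈ _
  generalize reducedProd (gen (CoxeterMatrix.A n)) w = x at hw ⊢
  induction hw with
  | one => exact one_mem _
  | @step w x i _ hi ih =>
    -- The product has a descent at `i`, so it cannot preserve the initial segment that ends at `i`.
    have hiJ : i ∈ J := by
      by_contra hJ
      have h1 := h i hJ i.castSucc
      have h2 := h i hJ i.succ
      have h3 : (w i.castSucc : ℕ) < w i.succ := hi
      simp at h1 h2
      omega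
    refine mul_mem (ih fun k hk x => ?_) (Submonoid.subset_closure ⟨i, hiJ, rfl⟩)
    have hki : (k : ℕ) ≠ i := fun e => hk (by rwa [Fin.ext e])
    have h1 := h k hk (adjSwap i x)
    have h2 : (w * adjSwap i) (adjSwap i x) = w x := by
      rw [← Equiv.Perm.mul_apply, mul_assoc, adjSwap_mul_self, mul_one]
    rw [h2, adjSwap_val] at h1
    rw [← h1]
    split_ifs <;> omega

theorem toPerm_le_iff {J : Set (Fin n)} {g : (CoxeterMatrix.A n).Group}
    (hg : g ∈ parabolicSubgroup (CoxeterMatrix.A n) J) {i : Fin n} (hi : i ∉ J)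
    (x : Fin (n + 1)) : (x : ℕ) ≤ i ↔ (toPerm n g x : ℕ) ≤ i := by
  induction hg using Subgroup.closure_induction generalizing x with
  | mem g hg =>
    obtain ⟨j, hj, rfl⟩ := hg
    have hij : (i : ℕ) ≠ j := fun e => hi (by rwa [Fin.ext e])
    rw [toPerm_simple, adjSwap_val]
    split_ifs <;> omega
  | one => simp
  | mul g h _ _ hg hh => rw [map_mul, Equiv.Perm.mul_apply, ← hg, ← hh]
  | inv g _ hg => rw [map_inv, hg ((toPerm n g)⁻¹ x)]; simp

/-- Maximal length makes every `j ∈ J` a descent, and descents are absorbed. -/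
theorem IsLongest.absorbs {J : Set (Fin n)} {g : (CoxeterMatrix.A n).Group}
    (hg : IsLongest (CoxeterMatrix.A n) J g) : Absorbs J (ofGroup g) := by
  rw [ofGroup_eq]
  refine ⟨ofPerm_mem fun i hi x => toPerm_le_iff hg.1 hi x, fun j hj => ?_⟩
  apply ofPerm_mul_gen_of_gt
  refine (lt_or_gt_succ _ j).resolve_left fun h => ?_
  have h1 := hg.2 (g * (CoxeterMatrix.A n).simple j)
    (mul_mem hg.1 (Subgroup.subset_closure ⟨j, hj, rfl⟩))
  rw [length_eq_permLength, length_eq_permLength, map_mul, toPerm_simple,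
    permLength_mul_of_lt h] at h1
  omega

theorem ofGroup_injective : Function.Injective (ofGroup (M := CoxeterMatrix.A n)) :=
  fun g h e => toPerm_injective n (ofPerm_injective (by
    rwa [ofGroup_eq, ofGroup_eq] at e))

/-- The Hecke monoid element `w_∘^J`. -/
noncomputable abbrev wLong (J : Set (Fin n)) : Hecke (CoxeterMatrix.A n) :=
  ofGroup (longest (CoxeterMatrix.A n) J)

theorem absorbs_wLong (J : Set (Fin n)) : Absorbs J (wLong J) := (isLongest_longest J).absorbs

theorem Absorbs.eq_wLong {J : Set (Fin n)} {x : Hecke (CoxeterMatrix.A n)} (h : Absorbs J x) :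
    x = wLong J := h.unique (absorbs_wLong J)

theorem wLong_empty : wLong (∅ : Set (Fin n)) = 1 := absorbs_empty.eq_wLong.symm

theorem wLong_singleton (i : Fin n) : wLong {i} = gen (CoxeterMatrix.A n) i :=
  (absorbs_singleton i).eq_wLong.symm

/-! ### Longest elements of intervals -/

/-- The set of generators that permute the points `p, …, q - 1`. -/
def cutSet (n p q : ℕ) : Set (Fin n) := {x | p < (x : ℕ) + 1 ∧ (x : ℕ) + 1 < q}

/-- The hypothesis forbids a 0 followed by a 1 inside the window, so the word reads 1…10…0 there:
slope one, then constant up to `q`. -/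
theorem Height.eq_of_sort_eq (c : Height) {p q : ℕ}
    (h : ∀ i, p < i → i < q → c i = min (c (i - 1) + 1) (c (i + 1))) {i : ℕ} (hp : p ≤ i)
    (hq : i ≤ q) : c i = min (c p + (i - p)) (c q) := by
  have flat : ∀ i, p < i → i ≤ q → c i = c (i - 1) → ∀ j, i ≤ j → j ≤ q → c j = c i := by
    intro i hi _ he j hj
    have hs : ∀ j, i ≤ j → j ≤ q → c j = c i ∧ c (j - 1) = c j := by
      intro j hj
      induction j, hj using Nat.le_induction with
      | base => exact fun _ => ⟨rfl, he.symm⟩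
      | succ j hj ih =>
        intro hq
        have h1 := ih (by omega)
        have h2 := h j (by omega) (by omega)
        have h3 := (c.2 j).1
        simp only [Nat.add_sub_cancel]
        omega
    exact fun hq => (hs j hj hq).1
  have key : c i = c p + (i - p) ∨ c i = c q := by
    induction i, hp using Nat.le_induction with
    | base => simp
    | succ i hp ih =>
      have h1 := c.2 i
      have h2 := c.mono hq
      rcases ih (by omega) with h3 | h3
      · by_cases h4 : c (i + 1) = c i
        · exact Or.inr (flat (i + 1) (by omega) hq (by simpa using h4) q hq le_rfl).symm
        · left; omega
      · right; omega
  have h1 := c.mono hq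
  have h2 := c.le_add hp
  omega

theorem Absorbs.act_cutSet {p q : ℕ} {x : Hecke (CoxeterMatrix.A n)}
    (hx : Absorbs (cutSet n p q) x) (hq : q ≤ n + 1) (c : Height) (i : ℕ) :
    act c x i = if p < i ∧ i < q then min (c p + (i - p)) (c q) else c i := by
  have hout : ∀ k, ¬ (p < k ∧ k < q) → act c x k = c k := fun k hk =>
    act_of_notMem hx.mem c fun j hj e => hk (by rw [e]; exact hj)
  split_ifs with h
  · rw [← hout p (by omega), ← hout q (by omega)]
    refine Height.eq_of_sort_eq _ (fun k h1 h2 => ?_) h.1.le h.2.le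
    obtain ⟨k, rfl⟩ := Nat.exists_eq_add_of_lt (Nat.zero_lt_of_lt h1)
    simp only [zero_add] at h1 h2 ⊢
    have hk : k < n := by omega
    have := congrArg (fun y => act c y (k + 1)) (hx.mul_gen ⟨k, hk⟩ ⟨h1, h2⟩)
    simp only [act_mul, act_gen, Height.sort_self] at this
    exact this.symm
  · exact hout i h

set_option linter.unusedSimpArgs false in
/-- The longest elements of two intervals satisfy the braid relation if the overlap is at least as
large as the two remainders. -/
theorem braid_of_overlap {p p' q q' : ℕ} {x y : Hecke (CoxeterMatrix.A n)}
    (hx : Absorbs (cutSet n p q) x) (hy : Absorbs (cutSet n p' q') y) (h1 : p < p') (h2 : p' < q)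
    (h3 : q < q') (h4 : q' ≤ n + 1) (h5 : p' - p ≤ q - p') (h6 : q' - q ≤ q - p') :
    Absorbs (cutSet n p q') (x * y * x) ∧ x * y * x = y * x * y := by
  have hz := absorbs_wLong (cutSet n p q')
  have e1 : x * y * x = wLong (cutSet n p q') := hecke_ext fun c k => by
    have m1 := c.mono h1.le
    have m2 := c.mono h2.le
    have m3 := c.mono h3.le
    have l1 := c.le_add h1.le
    have l2 := c.le_add h2.le
    have l3 := c.le_add h3.le
    rw [hz.act_cutSet h4]
    simp only [act_mul, hx.act_cutSet (h3.le.trans h4), hy.act_cutSet h4,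
      h1, h2, h3, h1.trans h2, h2.trans h3, lt_irrefl, and_true, true_and, and_false, false_and,
      if_true, if_false, not_lt_of_gt]
    split_ifs <;> omega
  have e2 : y * x * y = wLong (cutSet n p q') := hecke_ext fun c k => by
    have m1 := c.mono h1.le
    have m2 := c.mono h2.le
    have m3 := c.mono h3.le
    have l1 := c.le_add h1.le
    have l2 := c.le_add h2.le
    have l3 := c.le_add h3.le
    rw [hz.act_cutSet h4]
    simp only [act_mul, hx.act_cutSet (h3.le.trans h4), hy.act_cutSet h4,
      h1, h2, h3, h1.trans h2, h2.trans h3, lt_irrefl, and_true, true_and, and_false, false_and,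
      if_true, if_false, not_lt_of_gt]
    split_ifs <;> omega
  exact ⟨e1 ▸ hz, e1.trans e2.symm⟩

-- Two test words separate the products. If the ones start at `q`, then x y puts none before `p'`,
-- but a final x does. If they start at `p'`, then y x keeps the number of ones before `q`, whereas
-- x y x increases it.
set_option linter.unusedSimpArgs false in
theorem mul_ne_of_overlap {p p' q q' : ℕ} {x y : Hecke (CoxeterMatrix.A n)}
    (hx : Absorbs (cutSet n p q) x) (hy : Absorbs (cutSet n p' q') y) (h1 : p < p') (h2 : p' < q)
    (h3 : q < q') (h4 : q' ≤ n + 1) : x * y ≠ x * y * x ∧ y * x ≠ x * y * x := by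
  constructor
  · intro h
    have := congrArg (fun z => act (base n q) z p') h
    simp only [act_mul, hx.act_cutSet (h3.le.trans h4), hy.act_cutSet h4,
      base_apply, h1, h2, h3, h1.trans h2, h2.trans h3, lt_irrefl, and_true, true_and, and_false,
      false_and, if_true, if_false] at this
    split_ifs at this <;> omega
  · intro h
    have := congrArg (fun z => act (base n p') z q) h
    simp only [act_mul, hx.act_cutSet (h3.le.trans h4), hy.act_cutSet h4,
      base_apply, h1, h2, h3, h1.trans h2, h2.trans h3, lt_irrefl, and_true, true_and, and_false,
      false_and, if_true, if_false] at this
    split_ifs at this <;> omega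

theorem commute_of_disjoint {p p' q q' : ℕ} {x y : Hecke (CoxeterMatrix.A n)}
    (hx : Absorbs (cutSet n p q) x) (hy : Absorbs (cutSet n p' q') y) (h1 : p < q) (h2 : q ≤ p')
    (h3 : p' < q') (h4 : q' ≤ n + 1) : x * y = y * x :=
  hecke_ext fun c k => by
    simp only [act_mul, hx.act_cutSet (by omega), hy.act_cutSet h4]
    split_ifs <;> omega

theorem not_commute_of_overlap {p p' q q' : ℕ} {x y : Hecke (CoxeterMatrix.A n)}
    (hx : Absorbs (cutSet n p q) x) (hy : Absorbs (cutSet n p' q') y) (h1 : p < p') (h2 : p' < q)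
    (h3 : q < q') (h4 : q' ≤ n + 1) : x * y ≠ y * x := by
  intro h
  apply (mul_ne_of_overlap hx hy h1 h2 h3 h4).1
  rw [h, mul_assoc, hx.mul_self]

-- For ones starting at `p'`, with more places before the overlap than in it, y x y brings fewer
-- ones in front of `p'` than x y x. For ones starting at `q`, an overlap shorter than the right
-- remainder makes x y x fall behind y x y.
set_option linter.unusedSimpArgs false in
theorem overlap_of_braid {p p' q q' : ℕ} {x y : Hecke (CoxeterMatrix.A n)}
    (hx : Absorbs (cutSet n p q) x) (hy : Absorbs (cutSet n p' q') y) (h1 : p < p') (h2 : p' < q)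
    (h3 : q < q') (h4 : q' ≤ n + 1) (h : x * y * x = y * x * y) :
    p' - p ≤ q - p' ∧ q' - q ≤ q - p' := by
  constructor
  · have := congrArg (fun z => act (base n p') z p') h
    simp only [act_mul, hx.act_cutSet (h3.le.trans h4), hy.act_cutSet h4,
      base_apply, h1, h2, h3, h1.trans h2, h2.trans h3, lt_irrefl, and_true, true_and, and_false,
      false_and, if_true, if_false] at this
    split_ifs at this <;> omega
  · have := congrArg (fun z => act (base n q) z q) h
    simp only [act_mul, hx.act_cutSet (h3.le.trans h4), hy.act_cutSet h4,
      base_apply, h1, h2, h3, h1.trans h2, h2.trans h3, lt_irrefl, and_true, true_and, and_false,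
      false_and, if_true, if_false] at this
    split_ifs at this <;> omega

theorem cutSet_subset {p q p' q' : ℕ} (h1 : p' ≤ p) (h2 : q ≤ q') :
    cutSet n p q ⊆ cutSet n p' q' := fun x hx => by
  simp only [cutSet, Set.mem_ofPred_eq] at hx ⊢
  omega

theorem Absorbs.mul_eq_of_subset {J K : Set (Fin n)} {x y : Hecke (CoxeterMatrix.A n)}
    (hx : Absorbs J x) (hy : Absorbs K y) (h : K ⊆ J) : x * y = x :=
  hx.mul_of_mem (parabolicSubmonoid_mono _ h hy.mem)

theorem Absorbs.mul_eq_of_subset' {J K : Set (Fin n)} {x y : Hecke (CoxeterMatrix.A n)}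
    (hx : Absorbs J x) (hy : Absorbs K y) (h : K ⊆ J) : y * x = x :=
  hx.mul_of_mem' (parabolicSubmonoid_mono _ h hy.mem)

theorem Absorbs.subset_of_mul_eq {J K : Set (Fin n)} {x y : Hecke (CoxeterMatrix.A n)}
    (hx : Absorbs J x) (hy : Absorbs K y) (h : x * y = x) : K ⊆ J := fun k hk =>
  mem_of_mul_gen_eq hx.mem (by
    conv_lhs => rw [← h]
    rw [mul_assoc, hy.mul_gen k hk, h])

/-- Two intervals whose longest elements generate a Hecke monoid of type `A_2`. -/
theorem overlap_cases {p p' q q' : ℕ} {x y : Hecke (CoxeterMatrix.A n)}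
    (hx : Absorbs (cutSet n p q) x) (hy : Absorbs (cutSet n p' q') y) (h1 : p < q) (h2 : p' < q')
    (h3 : q ≤ n + 1) (h4 : q' ≤ n + 1) (h : x * y * x = y * x * y) (hxy : x * y ≠ x * y * x)
    (hyx : y * x ≠ x * y * x) :
    (p < p' ∧ p' < q ∧ q < q' ∧ p' - p ≤ q - p' ∧ q' - q ≤ q - p') ∨
      (p' < p ∧ p < q' ∧ q' < q ∧ p - p' ≤ q' - p ∧ q - q' ≤ q' - p) := by
  -- Nested windows absorb and disjoint ones commute; both would identify products assumed distinct,
  -- so a proper overlap remains.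
  have n1 : ¬ (p ≤ p' ∧ q' ≤ q) := fun h' => hxy (by
    rw [hx.mul_eq_of_subset hy (cutSet_subset h'.1 h'.2), hx.mul_self])
  have n2 : ¬ (p' ≤ p ∧ q ≤ q') := fun h' => hyx (by
    rw [h, hy.mul_eq_of_subset hx (cutSet_subset h'.1 h'.2), hy.mul_self])
  have n3 : x * y ≠ y * x := fun e => hxy (by rw [e, mul_assoc, hx.mul_self])
  have n4 : ¬ q ≤ p' := fun h' => n3 (commute_of_disjoint hx hy h1 h' h2 h4)
  have n5 : ¬ q' ≤ p := fun h' => n3 (commute_of_disjoint hy hx h2 h' h1 h3).symm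
  rcases Nat.lt_or_ge p p' with h5 | h5
  · have := overlap_of_braid hx hy h5 (by omega) (by omega) h4 h
    left; omega
  · have := overlap_of_braid hy hx (by omega) (by omega) (by omega) h3 h.symm
    right; omega

/-- Two intervals whose longest elements generate a Hecke monoid of type `A_1 × A_1`. -/
theorem disjoint_cases {p p' q q' : ℕ} {x y : Hecke (CoxeterMatrix.A n)}
    (hx : Absorbs (cutSet n p q) x) (hy : Absorbs (cutSet n p' q') y)
    (h3 : q ≤ n + 1) (h4 : q' ≤ n + 1) (h : x * y = y * x) (hxy : x * y ≠ x)
    (hyx : x * y ≠ y) : q ≤ p' ∨ q' ≤ p := by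
  have n1 : ¬ (p ≤ p' ∧ q' ≤ q) := fun h' => hxy
    (hx.mul_eq_of_subset hy (cutSet_subset h'.1 h'.2))
  have n2 : ¬ (p' ≤ p ∧ q ≤ q') := fun h' => hyx
    (hy.mul_eq_of_subset' hx (cutSet_subset h'.1 h'.2))
  by_contra hn
  rcases Nat.lt_or_ge p p' with h5 | h5
  · exact not_commute_of_overlap hx hy h5 (by omega) (by omega) h4 h
  · exact not_commute_of_overlap hy hx (by omega) (by omega) (by omega) h3 h.symm

/-! ### Injectivity on parabolic submonoids of rank two -/

theorem mem_rank_two_commute {N : Type*} [Monoid N] {s t x : N} (hs : s * s = s) (ht : t * t = t)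
    (h : s * t = t * s) (hx : x ∈ Submonoid.closure ({s, t} : Set N)) :
    x = 1 ∨ x = s ∨ x = t ∨ x = s * t := by
  induction hx using Submonoid.closure_induction_right with
  | one => exact Or.inl rfl
  | mul_right x _ y hy ih =>
    have e1 : s * t * s = s * t := by rw [h, mul_assoc, hs]
    have e2 : s * t * t = s * t := by rw [mul_assoc, ht]
    rcases hy with rfl | rfl <;> rcases ih with rfl | rfl | rfl | rfl <;>
      simp [hs, ht, ← h, e1, e2]

theorem mem_rank_two_braid {N : Type*} [Monoid N] {s t x : N} (hs : s * s = s) (ht : t * t = t)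
    (h : s * t * s = t * s * t) (hx : x ∈ Submonoid.closure ({s, t} : Set N)) :
    x = 1 ∨ x = s ∨ x = t ∨ x = s * t ∨ x = t * s ∨ x = s * t * s := by
  induction hx using Submonoid.closure_induction_right with
  | one => exact Or.inl rfl
  | mul_right x _ y hy ih =>
    have e1 : s * t * t = s * t := by rw [mul_assoc, ht]
    have e2 : t * s * s = t * s := by rw [mul_assoc, hs]
    have e3 : s * t * s * s = s * t * s := by rw [mul_assoc, hs]
    have e4 : s * t * s * t = s * t * s := by rw [h, mul_assoc, ht]
    rcases hy with rfl | rfl <;> rcases ih with rfl | rfl | rfl | rfl | rfl | rfl <;>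
      simp [hs, ht, ← h, e1, e2, e3, e4]

theorem injOn_rank_two_commute {N N' : Type*} [Monoid N] [Monoid N'] (φ : N →* N') {s t : N}
    (hs : s * s = s) (ht : t * t = t) (h : s * t = t * s) (h1 : φ s * φ t ≠ φ s)
    (h2 : φ s * φ t ≠ φ t) : Set.InjOn φ (Submonoid.closure ({s, t} : Set N)) := by
  have n1 : φ s ≠ 1 := fun e => h2 (by rw [e, one_mul])
  have n2 : φ t ≠ 1 := fun e => h1 (by rw [e, mul_one])
  have n3 : φ s ≠ φ t := fun e => h1 (by rw [← e, ← map_mul, hs])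
  have n4 : φ s * φ t ≠ 1 := fun e => n1 (by
    rw [← mul_one (φ s), ← e, ← mul_assoc, ← map_mul, hs])
  intro x hx y hy hxy
  rcases mem_rank_two_commute hs ht h hx with rfl | rfl | rfl | rfl <;>
    rcases mem_rank_two_commute hs ht h hy with rfl | rfl | rfl | rfl <;>
    first
    | rfl
    | (try simp only [map_mul, map_one] at hxy
       first | exact absurd hxy (by assumption) | exact absurd hxy.symm (by assumption))

/-- Any other coincidence among the six images leads, by multiplication, to one of the two excluded
ones. -/
theorem injOn_rank_two_braid {N N' : Type*} [Monoid N] [Monoid N'] (φ : N →* N') {s t : N}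
    (hs : s * s = s) (ht : t * t = t) (h : s * t * s = t * s * t)
    (h1 : φ s * φ t ≠ φ s * φ t * φ s) (h2 : φ t * φ s ≠ φ s * φ t * φ s) :
    Set.InjOn φ (Submonoid.closure ({s, t} : Set N)) := by
  have hs' : φ s * φ s = φ s := by rw [← map_mul, hs]
  have ht' : φ t * φ t = φ t := by rw [← map_mul, ht]
  have h' : φ s * φ t * φ s = φ t * φ s * φ t := by rw [← map_mul, ← map_mul, h, map_mul, map_mul]
  have a1 : φ s * φ t ≠ φ s := fun e => h1 (by rw [e, hs'])
  have a2 : φ t * φ s ≠ φ t := fun e => h2 (by rw [h', e, ht'])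
  have a3 : φ s * φ t ≠ φ t := fun e => h2 (by rw [e])
  have a4 : φ t * φ s ≠ φ s := fun e => h1 (by rw [h', e])
  have a5 : φ s ≠ 1 := fun e => a3 (by rw [e, one_mul])
  have a6 : φ t ≠ 1 := fun e => a4 (by rw [e, one_mul])
  have a7 : φ s ≠ φ t := fun e => a1 (by rw [← e, hs'])
  have a8 : φ s * φ t ≠ 1 := fun e => a5 (by rw [← mul_one (φ s), ← e, ← mul_assoc, hs'])
  have a9 : φ t * φ s ≠ 1 := fun e => a6 (by rw [← mul_one (φ t), ← e, ← mul_assoc, ht'])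
  have a10 : φ s * φ t ≠ φ t * φ s := fun e => h1 (by rw [e, mul_assoc, hs'])
  have a11 : φ s * φ t * φ s ≠ 1 := fun e => a5 (by
    rw [← mul_one (φ s), ← e, ← mul_assoc, ← mul_assoc, hs'])
  have a12 : φ s * φ t * φ s ≠ φ s := fun e => h1 (by
    have e1 : φ s * φ t * φ s * φ t = φ s * φ t := by rw [e]
    calc φ s * φ t = φ s * φ t * φ s * φ t := e1.symm
      _ = φ t * φ s * φ t := by rw [h', mul_assoc, ht']
      _ = φ s * φ t * φ s := h'.symm)
  have a13 : φ s * φ t * φ s ≠ φ t := fun e => h2 (by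
    have e1 : φ s * φ t * φ s * φ s = φ t * φ s := by rw [e]
    rw [← e1, mul_assoc, hs'])
  intro x hx y hy hxy
  rcases mem_rank_two_braid hs ht h hx with rfl | rfl | rfl | rfl | rfl | rfl <;>
    rcases mem_rank_two_braid hs ht h hy with rfl | rfl | rfl | rfl | rfl | rfl <;>
    first
    | rfl
    | (try simp only [map_mul, map_one] at hxy
       first | exact absurd hxy (by assumption) | exact absurd hxy.symm (by assumption))

/-! ### Connected subsets in type `A` -/

theorem coxeterGraph_A_adj {i j : Fin n} (h : (coxeterGraph (CoxeterMatrix.A n)).Adj i j) :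
    (i : ℕ) + 1 = j ∨ (j : ℕ) + 1 = i := by
  obtain ⟨h1, h2⟩ := h
  by_contra h3
  push Not at h3
  rcases lt_or_gt_of_ne h1 with h4 | h4
  · exact h2 (A_far (lt_of_le_of_ne h4 h3.1))
  · exact h2 (by rw [(CoxeterMatrix.A n).symmetric]; exact A_far (lt_of_le_of_ne h4 h3.2))

theorem coxeterGraph_A_adj_of {i j : Fin n} (h : (i : ℕ) + 1 = j) :
    (coxeterGraph (CoxeterMatrix.A n)).Adj i j :=
  ⟨by rintro rfl; omega, by rw [A_adj h]; decide⟩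

/-- Edges join consecutive indices only, so a path cannot jump over a missing index. -/
theorem connectedSubset_A_iff {J : Set (Fin n)} :
    ConnectedSubset (CoxeterMatrix.A n) J ↔ J.OrdConnected := by
  constructor
  · intro h
    refine ⟨fun x hx y hy z hz => ?_⟩
    by_contra hzJ
    have h1 := h ⟨x, hx⟩ ⟨y, hy⟩
    rw [SimpleGraph.reachable_iff_reflTransGen] at h1
    have h2 : ∀ u : J, Relation.ReflTransGen
        ((coxeterGraph (CoxeterMatrix.A n)).induce J).Adj ⟨x, hx⟩ u → (u : Fin n) < z := by
      intro u hu
      induction hu with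
      | refl => exact lt_of_le_of_ne hz.1 (by rintro rfl; exact hzJ hx)
      | @tail u v _ huv ih =>
        have h3 : ((u : Fin n) : ℕ) + 1 = (v : Fin n) ∨ ((v : Fin n) : ℕ) + 1 = (u : Fin n) :=
          coxeterGraph_A_adj huv
        have h4 : (v : Fin n) ≠ z := by rintro rfl; exact hzJ v.2
        have h5 : ((v : Fin n) : ℕ) ≠ z := fun e => h4 (Fin.ext e)
        rw [Fin.lt_def] at ih ⊢
        omega
    exact absurd (h2 ⟨y, hy⟩ h1) (not_lt_of_ge hz.2)
  · intro h
    have key : ∀ d : ℕ, ∀ x y : J, ((x : Fin n) : ℕ) + d = (y : Fin n) →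
        ((coxeterGraph (CoxeterMatrix.A n)).induce J).Reachable x y := by
      intro d
      induction d with
      | zero =>
        intro x y hxy
        obtain rfl : x = y := Subtype.ext (Fin.ext (by simpa using hxy))
        rfl
      | succ d ih =>
        intro x y hxy
        have hz : (⟨(x : Fin n) + d, by omega⟩ : Fin n) ∈ J :=
          h.out x.2 y.2 ⟨by simp [Fin.le_def], by simp [Fin.le_def]; omega⟩
        refine (ih x ⟨_, hz⟩ rfl).trans (SimpleGraph.Adj.reachable ?_)
        exact coxeterGraph_A_adj_of (by simp; omega)
    intro x y
    rcases le_total (x : Fin n) y with hxy | hxy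
    · exact key _ x y (Nat.add_sub_of_le hxy)
    · exact (key _ y x (Nat.add_sub_of_le hxy)).symm

theorem exists_cutSet_of_ordConnected {J : Set (Fin n)} (h : J.OrdConnected) (hJ : J.Nonempty) :
    ∃ p q, p + 2 ≤ q ∧ q ≤ n + 1 ∧ J = cutSet n p q := by
  obtain ⟨a, ha, ha'⟩ := J.toFinite.exists_minimal hJ
  obtain ⟨b, hb, hb'⟩ := J.toFinite.exists_maximal hJ
  have h1 : ∀ x ∈ J, a ≤ x ∧ x ≤ b := fun x hx =>
    ⟨(le_total a x).elim id (fun h => ha' hx h), (le_total x b).elim id (fun h => hb' hx h)⟩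
  have hab : (a : ℕ) ≤ b := (h1 a ha).2
  -- The generator `b` moves the points `b` and `b + 1`, so the half-open window of points ends at
  -- `b + 2`.
  refine ⟨a, b + 2, by omega, by omega, ?_⟩
  ext x
  simp only [cutSet, Set.mem_ofPred_eq]
  constructor
  · intro hx
    have h2 : (a : ℕ) ≤ x := (h1 x hx).1
    have h3 : (x : ℕ) ≤ b := (h1 x hx).2
    omega
  · intro hx
    exact h.out ha hb ⟨by rw [Fin.le_def]; omega, by rw [Fin.le_def]; omega⟩

theorem suppMap_singleton {B' B : Type*} {M' : CoxeterMatrix B'} {M : CoxeterMatrix B}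
    (φ : Hecke M' →* Hecke M) (j : B') : suppMap φ {j} = supp (φ (gen M' j)) := by
  simp [suppMap]

/-! ### The homomorphisms attached to restricted partitions -/

theorem partialSum_zero {k : ℕ} (l : Fin (k + 1) → ℕ) : partialSum l 0 = 0 := rfl

theorem partialSum_one {k : ℕ} (l : Fin (k + 1) → ℕ) : partialSum l 1 = l (Fin.last k) := by
  simp [partialSum]

theorem partialSum_succ {k : ℕ} (l : Fin (k + 1) → ℕ) (i : ℕ) (hi : i < k + 1) :
    partialSum l (i + 2) = partialSum l (i + 1) + l ⟨i, hi⟩ := by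
  have : Finset.univ.filter (fun j : Fin (k + 1) => (j : ℕ) + 1 < i + 2) =
      insert ⟨i, hi⟩ (Finset.univ.filter (fun j : Fin (k + 1) => (j : ℕ) + 1 < i + 1)) := by
    ext j
    simp only [Finset.mem_filter, Finset.mem_univ, true_and, Finset.mem_insert, Fin.ext_iff]
    omega
  simp only [partialSum, Nat.add_eq_zero_iff, OfNat.ofNat_ne_zero, one_ne_zero, and_false, if_false,
    this]
  rw [Finset.sum_insert (by simp)]
  omega

theorem partialSum_last {k : ℕ} (l : Fin (k + 1) → ℕ) : partialSum l (k + 1) = ∑ j, l j := by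
  rw [Fin.sum_univ_castSucc]
  have : Finset.univ.filter (fun j : Fin (k + 1) => (j : ℕ) + 1 < k + 1) =
      Finset.univ.map Fin.castSuccEmb := by
    ext j
    simp only [Finset.mem_filter, Finset.mem_univ, true_and, Finset.mem_map]
    constructor
    · intro hj
      exact ⟨⟨j, by omega⟩, rfl⟩
    · rintro ⟨x, rfl⟩
      simp
  rw [partialSum, if_neg (by omega), this, Finset.sum_map, add_comm]
  rfl

theorem interval_eq_cutSet (n : ℕ) {k : ℕ} (l : Fin (k + 1) → ℕ) (i : Fin k) :
    interval n l i = cutSet n (partialSum l i) (partialSum l (i + 2)) := by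
  ext x
  simp [interval, cutSet]

/-- The cut points `0 = a_0 < a_1 < ⋯ < a_{k+1} = n + 1` of a composition of `n + 1` into `k + 1`
parts such that each inner part is at least as large as its neighbours. -/
structure IsChain (k n : ℕ) (a : ℕ → ℕ) : Prop where
  zero : a 0 = 0
  last : a (k + 1) = n + 1
  lt : ∀ i, i ≤ k → a i < a (i + 1)
  le_left : ∀ i, i + 2 ≤ k → a (i + 1) - a i ≤ a (i + 2) - a (i + 1)
  le_right : ∀ i, i + 2 ≤ k → a (i + 3) - a (i + 2) ≤ a (i + 2) - a (i + 1)

theorem IsChain.strict {k n : ℕ} {a : ℕ → ℕ} (h : IsChain k n a) {i j : ℕ} (hij : i < j)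
    (hj : j ≤ k + 1) : a i < a j := by
  induction j, hij using Nat.le_induction with
  | base => exact h.lt i (by omega)
  | succ j hij ih => exact (ih (by omega)).trans (h.lt j (by omega))

theorem IsChain.le_last {k n : ℕ} {a : ℕ → ℕ} (h : IsChain k n a) {i : ℕ} (hi : i ≤ k + 1) :
    a i ≤ n + 1 := by
  rw [← h.last]
  rcases hi.lt_or_eq with h1 | rfl
  · exact (h.strict h1 le_rfl).le
  · exact le_rfl

/-- The blocks, from left to right, are λ_r, λ_1, …, λ_{r-1}: the smallest part first, then the
equal parts, then λ_{r-1}. -/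
theorem isChain_partialSum {k n : ℕ} {l : Fin (k + 1) → ℕ}
    (hl : l ∈ restrictedPartitions (k + 1) (n + 1)) : IsChain k n (partialSum l) := by
  obtain ⟨h1, h2, h3, h4⟩ := hl
  have hd : ∀ i, (hi : i < k + 1) → partialSum l (i + 2) = partialSum l (i + 1) + l ⟨i, hi⟩ :=
    partialSum_succ l
  have h5 : l (Fin.last k) = partialSum l 1 := (partialSum_one l).symm
  refine ⟨rfl, ?_, ?_, ?_, ?_⟩
  · rw [partialSum_last, h4]
  · intro i hi
    rcases i with _ | i
    · rw [partialSum_zero, partialSum_one]; exact h1 _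
    · rw [hd i (by omega)]; have := h1 ⟨i, by omega⟩; omega
  · intro i hi
    have e1 := hd i (by omega)
    rcases i with _ | i
    · have e2 := h2 (Fin.le_last (⟨0, by omega⟩ : Fin (k + 1)))
      simp only [partialSum_zero, zero_add] at e1 e2 ⊢
      omega
    · have e2 := hd i (by omega)
      have e3 := h3 ⟨i, by omega⟩ ⟨i + 1, by omega⟩ (by simp; omega) (by simp; omega)
      simp only [add_assoc, Nat.reduceAdd] at e1 e2 ⊢
      omega
  · intro i hi
    have e1 := hd i (by omega)
    have e2 := hd (i + 1) (by omega)
    have e3 := h2 (show (⟨i, by omega⟩ : Fin (k + 1)) ≤ ⟨i + 1, by omega⟩ by simp [Fin.le_def])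
    simp only [add_assoc, Nat.reduceAdd] at e1 e2 ⊢
    omega

section Chain

variable {k : ℕ} {a : ℕ → ℕ}

theorem IsChain.braidFamily (h : IsChain k n a) :
    BraidFamily fun i : Fin k => wLong (cutSet n (a i) (a (i + 2))) where
  comm i j hij := commute_of_disjoint (absorbs_wLong _) (absorbs_wLong _)
    (h.strict (by omega) (by omega)) (by
      rcases Nat.lt_or_ge ((i : ℕ) + 2) j with h1 | h1
      · exact (h.strict h1 (by omega)).le
      · rw [show (i : ℕ) + 2 = j by omega]) (h.strict (by omega) (by omega)) (h.le_last (by omega))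
  braid i j hij := by
    rw [← hij]
    exact (braid_of_overlap (absorbs_wLong _) (absorbs_wLong _) (h.lt i (by omega))
      (h.lt _ (by omega)) (h.lt _ (by omega)) (h.le_last (by omega)) (h.le_left i (by omega))
      (h.le_right i (by omega))).2

theorem IsChain.locallyInjective (h : IsChain k n a)
    {ψ : Hecke (CoxeterMatrix.A k) →* Hecke (CoxeterMatrix.A n)}
    (hψ : ∀ i : Fin k, ψ (gen (CoxeterMatrix.A k) i) = wLong (cutSet n (a i) (a (i + 2)))) :
    LocallyInjective ψ := by
  have key : ∀ i j : Fin k, i < j →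
      Set.InjOn ψ (parabolicSubmonoid (CoxeterMatrix.A k) {i, j} : Set (Hecke _)) := by
    intro i j hij
    rw [parabolicSubmonoid, Set.image_pair]
    have hij' : (i : ℕ) + 1 ≤ j := hij
    have hx := hψ i ▸ absorbs_wLong (cutSet n (a i) (a (i + 2)))
    have hy := hψ j ▸ absorbs_wLong (cutSet n (a j) (a (j + 2)))
    rcases hij'.lt_or_eq with h1 | h1
    · have l1 := h.lt i (by omega)
      have l2 := h.lt (i + 1) (by omega)
      have l3 := h.lt j (by omega)
      have l4 := h.lt (j + 1) (by omega)
      have l5 := h.strict (i := i) (j := j) (by omega) (by omega)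
      have l6 := h.strict (i := i + 2) (j := j + 2) (by omega) (by omega)
      have l7 := h.le_last (i := j + 2) (by omega)
      simp only [add_assoc, Nat.reduceAdd] at l2 l4
      refine injOn_rank_two_commute ψ (gen_idem _ i) (gen_idem _ j)
        ((braidFamily_gen k).comm i j h1) (fun e => ?_) (fun e => ?_)
      -- The last generator of the later window lies outside the earlier one; below, the first
      -- generator of the earlier window plays the mirrored role.
      · have hm : (⟨a (j + 2) - 2, by omega⟩ : Fin n) ∈ cutSet n (a j) (a (j + 2)) := by
          simp only [cutSet, Set.mem_ofPred_eq]; omega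
        have := (hx.subset_of_mul_eq hy e) hm
        simp only [cutSet, Set.mem_ofPred_eq] at this
        omega
      · rw [← map_mul, (braidFamily_gen k).comm i j h1, map_mul] at e
        have hm : (⟨a i, by omega⟩ : Fin n) ∈ cutSet n (a i) (a (i + 2)) := by
          simp only [cutSet, Set.mem_ofPred_eq]; omega
        have := (hy.subset_of_mul_eq hx e) hm
        simp only [cutSet, Set.mem_ofPred_eq] at this
        omega
    · rw [← h1] at hy
      have := mul_ne_of_overlap hx hy (h.lt i (by omega)) (h.lt _ (by omega)) (h.lt _ (by omega))
        (h.le_last (by omega))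
      exact injOn_rank_two_braid ψ (gen_idem _ i) (gen_idem _ j)
        ((braidFamily_gen k).braid i j h1) this.1 this.2
  intro i j hij
  rcases lt_or_gt_of_ne hij with h1 | h1
  · exact key i j h1
  · rw [Set.pair_comm]; exact key j i h1

theorem IsChain.isConnectedHom (h : IsChain k n a)
    {ψ : Hecke (CoxeterMatrix.A k) →* Hecke (CoxeterMatrix.A n)}
    (hψ : ∀ i : Fin k, ψ (gen (CoxeterMatrix.A k) i) = wLong (cutSet n (a i) (a (i + 2)))) :
    IsConnectedHom ψ := by
  have hs : ∀ i, supp (ψ (gen (CoxeterMatrix.A k) i)) = cutSet n (a i) (a (i + 2)) := fun i => by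
    rw [hψ, (absorbs_wLong _).supp_eq]
  intro J hJ
  rw [connectedSubset_A_iff] at hJ ⊢
  refine ⟨fun x hx y hy z hz => ?_⟩
  simp only [suppMap, hs, Set.mem_iUnion, exists_prop] at hx hy ⊢
  obtain ⟨i, hi, hx⟩ := hx
  obtain ⟨j, hj, hy⟩ := hy
  simp only [cutSet, Set.mem_ofPred_eq] at hx hy ⊢
  have hxz : (x : ℕ) ≤ z := hz.1
  have hzy : (z : ℕ) ≤ y := hz.2
  by_cases h1 : (z : ℕ) + 1 < a (i + 2)
  · exact ⟨i, hi, by omega, h1⟩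
  have hij : (i : ℕ) < j := by
    by_contra h2
    rcases (not_lt.1 h2).lt_or_eq with h3 | h3
    · have := h.strict (i := j + 2) (j := i + 2) (by omega) (by omega)
      omega
    · rw [h3] at hy; omega
  -- The first window from `i` on that ends beyond `z` contains it: the preceding window has ended
  -- by `z`, and this one starts before that end.
  have key : ∀ d : ℕ, ∀ hd : (i : ℕ) + d ≤ j, (z : ℕ) + 1 < a (i + d + 2) →
      ∃ m ∈ J, a m < (z : ℕ) + 1 ∧ (z : ℕ) + 1 < a (m + 2) := by
    intro d
    induction d with
    | zero => exact fun _ h2 => absurd h2 h1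
    | succ d ih =>
      intro hd h2
      by_cases h3 : (z : ℕ) + 1 < a (i + d + 2)
      · exact ih (by omega) h3
      · refine ⟨⟨i + (d + 1), by omega⟩, hJ.out hi hj ⟨?_, ?_⟩, ?_, h2⟩
        · simp [Fin.le_def]
        · simpa [Fin.le_def] using hd
        · have := h.lt (i + d + 1) (by omega)
          change a (i + d + 1) < _
          simp only [add_assoc, Nat.reduceAdd] at this h3 ⊢
          omega
  exact key (j - i) (by omega) (by rw [Nat.add_sub_of_le hij.le]; omega)

end Chain

/-! ### Diagram automorphisms -/

variable {k : ℕ}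

theorem diagramHom_gen {B : Type*} {M : CoxeterMatrix B} (σ : DiagramAut M) (i : B) :
    diagramHom σ (gen M i) = gen M (σ.1 i) := rfl

theorem diagramHom_wLong (σ : DiagramAut (CoxeterMatrix.A n)) (J : Set (Fin n)) :
    diagramHom σ (wLong J) = wLong (σ.1 '' J) := by
  refine Absorbs.eq_wLong ⟨?_, ?_⟩
  · have h : (parabolicSubmonoid (CoxeterMatrix.A n) J).map (diagramHom σ) ≤
        parabolicSubmonoid (CoxeterMatrix.A n) (σ.1 '' J) := by
      rw [parabolicSubmonoid, MonoidHom.map_mclosure, Submonoid.closure_le]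
      rintro _ ⟨_, ⟨j, hj, rfl⟩, rfl⟩
      exact Submonoid.subset_closure ⟨σ.1 j, ⟨j, hj, rfl⟩, rfl⟩
    exact h ⟨_, (absorbs_wLong J).mem, rfl⟩
  · rintro _ ⟨j, hj, rfl⟩
    rw [← diagramHom_gen, ← map_mul, (absorbs_wLong J).mul_gen j hj]

/-- The trivial diagram automorphism. -/
def idAut {B : Type*} (M : CoxeterMatrix B) : DiagramAut M := ⟨Equiv.refl B, fun _ _ => rfl⟩

/-- The composition of two diagram automorphisms. -/
def mulAut {B : Type*} {M : CoxeterMatrix B} (σ τ : DiagramAut M) : DiagramAut M :=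
  ⟨σ.1 * τ.1, fun i j => by simp only [Equiv.Perm.mul_apply, σ.2, τ.2]⟩

theorem diagramHom_idAut {B : Type*} (M : CoxeterMatrix B) :
    diagramHom (idAut M) = MonoidHom.id (Hecke M) := heckeHom_ext fun _ => rfl

theorem diagramHom_mulAut {B : Type*} {M : CoxeterMatrix B} (σ τ : DiagramAut M) :
    diagramHom (mulAut σ τ) = (diagramHom σ).comp (diagramHom τ) := heckeHom_ext fun _ => rfl

/-- The automorphism of the diagram of type `A_n` that reverses the order. -/
def revAut (n : ℕ) : DiagramAut (CoxeterMatrix.A n) :=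
  ⟨Fin.revPerm, fun i j => by
    simp only [CoxeterMatrix.A, Fin.revPerm_apply, Matrix.of_apply, Fin.rev_inj, Fin.val_rev]
    split_ifs <;> first | rfl | omega⟩

theorem revAut_val (i : Fin n) : ((revAut n).1 i : ℕ) = n - (i + 1) := Fin.val_rev i

theorem diagramHom_revAut_comp (n : ℕ) :
    (diagramHom (revAut n)).comp (diagramHom (revAut n)) = MonoidHom.id _ := by
  rw [← diagramHom_mulAut, ← diagramHom_idAut]
  congr 1
  exact Subtype.ext (Equiv.ext fun i => Fin.rev_rev i)

theorem revAut_image_cutSet {p q : ℕ} (hp : p ≤ n + 1) (hq : q ≤ n + 1) :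
    (revAut n).1 '' cutSet n p q = cutSet n (n + 1 - q) (n + 1 - p) := by
  ext x
  have hx := x.2
  simp only [cutSet, Set.mem_image, Set.mem_ofPred_eq]
  constructor
  · rintro ⟨y, hy, rfl⟩
    rw [revAut_val]
    omega
  · intro h
    refine ⟨(revAut n).1 x, ?_, Fin.rev_rev x⟩
    rw [revAut_val]
    omega

theorem IsPsiUpToDiagramAut.comp {φ : Hecke (CoxeterMatrix.A k) →* Hecke (CoxeterMatrix.A n)}
    (h : IsPsiUpToDiagramAut φ) (σ : DiagramAut (CoxeterMatrix.A n))
    (σ' : DiagramAut (CoxeterMatrix.A k)) :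
    IsPsiUpToDiagramAut ((diagramHom σ).comp (φ.comp (diagramHom σ'))) := by
  obtain ⟨l, hl, ψ, hψ, τ, τ', rfl⟩ := h
  refine ⟨l, hl, ψ, hψ, mulAut σ τ, mulAut τ' σ', ?_⟩
  rw [diagramHom_mulAut, diagramHom_mulAut]
  rfl

/-! ### Reconstruction of the partition -/

theorem IsChain.exists_partition {a : ℕ → ℕ} (h : IsChain k n a) (hk : 1 ≤ k)
    (ha : a 1 - a 0 ≤ a (k + 1) - a k) :
    ∃ l ∈ restrictedPartitions (k + 1) (n + 1), ∀ i ≤ k + 1, partialSum l i = a i := by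
  -- The first block becomes the last part; all other blocks keep their order.
  let l : Fin (k + 1) → ℕ := fun j => if (j : ℕ) = k then a 1 else a (j + 2) - a (j + 1)
  have hl1 : l (Fin.last k) = a 1 := by simp [l]
  have hl2 : ∀ j : Fin (k + 1), (j : ℕ) < k → l j = a (j + 2) - a (j + 1) := fun j hj => by
    simp [l, hj.ne]
  have hP : ∀ i ≤ k, partialSum l (i + 1) = a (i + 1) := by
    intro i hi
    induction i with
    | zero => rw [partialSum_one, hl1]
    | succ i ih =>
      rw [partialSum_succ l i (by omega), ih (by omega), hl2 _ (by simp; omega)]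
      have := h.lt (i + 1) hi
      simp only [add_assoc, Nat.reduceAdd] at this ⊢
      omega
  have hP' : ∀ i ≤ k + 1, partialSum l i = a i := by
    intro i hi
    rcases i with _ | i
    · rw [partialSum_zero, h.zero]
    · exact hP i (by omega)
  -- All blocks after the first weakly decrease, and the inner ones also weakly increase (`hinc`).
  -- Hence the inner blocks are equal.
  have hdec : ∀ i j, i ≤ j → j < k → a (j + 2) - a (j + 1) ≤ a (i + 2) - a (i + 1) := by
    intro i j hij
    induction j, hij using Nat.le_induction with
    | base => exact fun _ => le_rfl
    | succ j hij ih => exact fun hj => (h.le_right j (by omega)).trans (ih (by omega))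
  have hinc : ∀ i j, i ≤ j → j + 1 < k → a (i + 2) - a (i + 1) ≤ a (j + 2) - a (j + 1) := by
    intro i j hij
    induction j, hij using Nat.le_induction with
    | base => exact fun _ => le_rfl
    | succ j hij ih => exact fun hj => (ih (by omega)).trans (h.le_left (j + 1) (by omega))
  refine ⟨l, ⟨fun j => ?_, fun i j hij => ?_, fun i j hi hj => ?_, ?_⟩, hP'⟩
  · rcases Nat.lt_or_ge (j : ℕ) k with hj | hj
    · rw [hl2 j hj]
      have := h.lt (j + 1) (by omega)
      simp only [add_assoc, Nat.reduceAdd] at this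
      omega
    · obtain rfl : j = Fin.last k := Fin.ext (by simp; omega)
      rw [hl1]
      have := h.lt 0 (by omega)
      simp only [zero_add] at this
      omega
  · have hij' : (i : ℕ) ≤ j := hij
    rcases Nat.lt_or_ge (j : ℕ) k with hj | hj
    · rw [hl2 j hj, hl2 i (by omega)]
      exact hdec i j hij' hj
    · obtain rfl : j = Fin.last k := Fin.ext (by simp; omega)
      rcases Nat.lt_or_ge (i : ℕ) k with hi | hi
      · rw [hl1, hl2 i hi]
        have := hdec i (k - 1) (by omega) (by omega)
        rw [show k - 1 + 2 = k + 1 by omega, show k - 1 + 1 = k by omega] at this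
        rw [h.zero] at ha
        omega
      · obtain rfl : i = Fin.last k := Fin.ext (by simp; omega)
        exact le_rfl
  · rw [hl2 i (by omega), hl2 j (by omega)]
    rcases le_total (i : ℕ) j with h1 | h1
    · exact le_antisymm (hinc i j h1 (by omega)) (hdec i j h1 (by omega))
    · exact le_antisymm (hdec j i h1 (by omega)) (hinc j i h1 (by omega))
  · rw [← partialSum_last, hP k le_rfl, h.last]

theorem IsChain.flip {a : ℕ → ℕ} (h : IsChain k n a) :
    IsChain k n fun i => n + 1 - a (k + 1 - i) where
  zero := by simp [h.last]
  last := by simp [h.zero]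
  lt i hi := by
    have h1 := h.lt (k - i) (by omega)
    have h2 := h.le_last (i := k - i + 1) (by omega)
    rw [show k + 1 - i = k - i + 1 by omega, show k + 1 - (i + 1) = k - i by omega]
    omega
  le_left i hi := by
    obtain ⟨j, rfl⟩ := Nat.exists_eq_add_of_le hi
    have h1 := h.le_right j (by omega)
    have h2 := h.le_last (i := j + 3) (by omega)
    have h3 := h.lt j (by omega)
    have h4 := h.lt (j + 1) (by omega)
    have h5 := h.lt (j + 2) (by omega)
    rw [show i + 2 + j + 1 - i = j + 3 by omega, show i + 2 + j + 1 - (i + 1) = j + 2 by omega,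
      show i + 2 + j + 1 - (i + 2) = j + 1 by omega]
    simp only [add_assoc, Nat.reduceAdd] at h4 h5
    omega
  le_right i hi := by
    obtain ⟨j, rfl⟩ := Nat.exists_eq_add_of_le hi
    have h1 := h.le_left j (by omega)
    have h2 := h.le_last (i := j + 2) (by omega)
    have h3 := h.lt j (by omega)
    have h4 := h.lt (j + 1) (by omega)
    rw [show i + 2 + j + 1 - (i + 1) = j + 2 by omega,
      show i + 2 + j + 1 - (i + 2) = j + 1 by omega, show i + 2 + j + 1 - (i + 3) = j by omega]
    simp only [add_assoc, Nat.reduceAdd] at h4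
    omega

theorem IsChain.isPsiUpToDiagramAut {a : ℕ → ℕ} (h : IsChain k n a) (hk : 1 ≤ k)
    {φ : Hecke (CoxeterMatrix.A k) →* Hecke (CoxeterMatrix.A n)}
    (hφ : ∀ i : Fin k, φ (gen (CoxeterMatrix.A k) i) = wLong (cutSet n (a i) (a (i + 2)))) :
    IsPsiUpToDiagramAut φ := by
  have key : ∀ (a : ℕ → ℕ) (_ : IsChain k n a) (_ : a 1 - a 0 ≤ a (k + 1) - a k)
      (φ : Hecke (CoxeterMatrix.A k) →* Hecke (CoxeterMatrix.A n))
      (_ : ∀ i : Fin k, φ (gen (CoxeterMatrix.A k) i) = wLong (cutSet n (a i) (a (i + 2)))),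
      IsPsiUpToDiagramAut φ := by
    intro a h ha φ hφ
    obtain ⟨l, hl, hla⟩ := h.exists_partition hk ha
    refine ⟨l, hl, φ, fun i => ?_, idAut _, idAut _, ?_⟩
    · rw [hφ, interval_eq_cutSet, hla i (by omega), hla (i + 2) (by omega)]
    · rw [diagramHom_idAut, diagramHom_idAut]
      rfl
  rcases le_total (a 1 - a 0) (a (k + 1) - a k) with ha | ha
  · exact key a h ha φ hφ
  -- If the first block is longer than the last, reversing both diagrams exchanges the two.
  · have h1 := key _ h.flip (by
      have h2 := h.le_last (i := k) (by omega)
      have h3 := h.last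
      have h4 := h.le_last (i := 1) (by omega)
      simp only [Nat.add_sub_cancel, Nat.sub_zero, Nat.sub_self,
        show k + 1 - k = 1 by omega]
      omega) ((diagramHom (revAut n)).comp (φ.comp (diagramHom (revAut k)))) (fun i => by
      rw [MonoidHom.comp_apply, MonoidHom.comp_apply, diagramHom_gen, hφ, diagramHom_wLong,
        revAut_image_cutSet (h.le_last (by omega)) (h.le_last (by rw [revAut_val]; omega)),
        revAut_val, show k - ((i : ℕ) + 1) + 2 = k + 1 - i by omega,
        show k + 1 - ((i : ℕ) + 2) = k - (i + 1) by omega])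
    have h2 := h1.comp (revAut n) (revAut k)
    have h3 : (diagramHom (revAut n)).comp (((diagramHom (revAut n)).comp
        (φ.comp (diagramHom (revAut k)))).comp (diagramHom (revAut k))) =
        ((diagramHom (revAut n)).comp (diagramHom (revAut n))).comp
          (φ.comp ((diagramHom (revAut k)).comp (diagramHom (revAut k)))) := rfl
    rw [h3, diagramHom_revAut_comp, diagramHom_revAut_comp] at h2
    exact h2

theorem exists_isChain_of_right {P Q : ℕ → ℕ} (hk : 1 ≤ k) (hn : 1 ≤ n)
    (hPQ : ∀ i < k, P i + 2 ≤ Q i ∧ Q i ≤ n + 1)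
    (hadj : ∀ i, i + 1 < k → P i < P (i + 1) ∧ P (i + 1) < Q i ∧ Q i < Q (i + 1) ∧
      P (i + 1) - P i ≤ Q i - P (i + 1) ∧ Q (i + 1) - Q i ≤ Q i - P (i + 1))
    (hfar : ∀ i j, i + 1 < j → j < k → Q i ≤ P j ∨ Q j ≤ P i)
    (hcov : ∀ x, 1 ≤ x → x ≤ n → ∃ i < k, P i < x ∧ x < Q i) :
    ∃ a, IsChain k n a ∧ ∀ i < k, P i = a i ∧ Q i = a (i + 2) := by
  -- Left ends increase with the index, so whichever window covers the first generator, window 0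
  -- starts at 0. The right end is treated likewise.
  have hP0 : P 0 = 0 := by
    obtain ⟨i, hi, h1, -⟩ := hcov 1 le_rfl hn
    have : ∀ j, j < k → P 0 ≤ P j := by
      intro j
      induction j with
      | zero => exact fun _ => le_rfl
      | succ j ih => exact fun hj => (ih (by omega)).trans (hadj j hj).1.le
    have := this i hi
    omega
  have hQl : Q (k - 1) = n + 1 := by
    obtain ⟨i, hi, -, h1⟩ := hcov n hn le_rfl
    have : ∀ j, i ≤ j → j < k → Q i ≤ Q j := by
      intro j hj
      induction j, hj using Nat.le_induction with
      | base => exact fun _ => le_rfl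
      | succ j hj ih => exact fun hj => (ih (by omega)).trans (hadj j hj).2.2.1.le
    have := this (k - 1) (by omega) (by omega)
    have := (hPQ (k - 1) (by omega)).2
    omega
  -- Disjointness gives `Q i ≤ P (i + 2)`. The overlap bounds put `Q i` at or beyond the midpoint of
  -- window `i + 1`, and `P (i + 2)` at or before it.
  have hQP : ∀ i, i + 2 < k → Q i = P (i + 2) := by
    intro i hi
    have h1 := hadj i (by omega)
    have h2 := hadj (i + 1) hi
    have h3 := hfar i (i + 2) (by omega) hi
    simp only [add_assoc, Nat.reduceAdd] at h2
    omega
  -- For `k = 1` nothing determines the single inner cut; the value 1 is a valid choice because `1 ≤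
  -- n`.
  let a : ℕ → ℕ := fun i => if i < k then P i else if i = k then (if k = 1 then 1 else Q (k - 2))
    else Q (k - 1)
  have haP : ∀ i < k, P i = a i := fun i hi => by simp [a, hi]
  have haQ : ∀ i < k, Q i = a (i + 2) := fun i hi => by
    rcases lt_trichotomy (i + 2) k with h1 | h1 | h1
    · simp only [a, h1, if_true]; exact hQP i h1
    · have h2 : k ≠ 1 := by omega
      simp only [a, h1, lt_irrefl, if_false, if_true, h2]
      congr 1; omega
    · have h2 : ¬ i + 2 < k := by omega
      have h3 : ¬ i + 2 = k := by omega
      simp only [a, h2, h3, if_false]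
      congr 1; omega
  have key : ∀ i, i + 1 < k → a i < a (i + 1) ∧ a (i + 1) < a (i + 2) ∧ a (i + 2) < a (i + 3) ∧
      a (i + 1) - a i ≤ a (i + 2) - a (i + 1) ∧ a (i + 3) - a (i + 2) ≤ a (i + 2) - a (i + 1) := by
    intro i hi
    have := hadj i hi
    rwa [haP i (by omega), haP (i + 1) hi, haQ i (by omega), haQ (i + 1) hi] at this
  refine ⟨a, ⟨?_, ?_, ?_, ?_, ?_⟩, fun i hi => ⟨haP i hi, haQ i hi⟩⟩
  · rw [← haP 0 (by omega), hP0]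
  · rw [← hQl, haQ (k - 1) (by omega)]
    congr 1; omega
  · intro i hi
    rcases eq_or_ne k 1 with rfl | hk1
    · have h1 : a 0 = 0 := by rw [← haP 0 (by omega), hP0]
      have h2 : a 1 = 1 := by simp [a]
      have h3 : a 2 = n + 1 := by rw [← hQl]; exact (haQ 0 (by omega)).symm
      interval_cases i
      · rw [zero_add, h1, h2]; exact Nat.one_pos
      · rw [h2, h3]; omega
    · rcases Nat.lt_or_ge (i + 1) k with h1 | h1
      · exact (key i h1).1
      · have h2 := key (k - 2) (by omega)
        rcases hi.lt_or_eq with h3 | rfl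
        · obtain rfl : k = i + 1 := by omega
          rw [show i + 1 - 2 + 1 = i by omega, show i + 1 - 2 + 2 = i + 1 by omega] at h2
          exact h2.2.1
        · rw [show i - 2 + 2 = i by omega, show i - 2 + 3 = i + 1 by omega] at h2
          exact h2.2.2.1
  · exact fun i hi => (key i hi).2.2.2.1
  · exact fun i hi => (key i hi).2.2.2.2

theorem exists_isChain {P Q : ℕ → ℕ} (hk : 1 ≤ k) (hn : 1 ≤ n)
    (hPQ : ∀ i < k, P i + 2 ≤ Q i ∧ Q i ≤ n + 1)
    (hadj : ∀ i, i + 1 < k → (P i < P (i + 1) ∧ P (i + 1) < Q i ∧ Q i < Q (i + 1) ∧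
      P (i + 1) - P i ≤ Q i - P (i + 1) ∧ Q (i + 1) - Q i ≤ Q i - P (i + 1)) ∨
      (P (i + 1) < P i ∧ P i < Q (i + 1) ∧ Q (i + 1) < Q i ∧
      P i - P (i + 1) ≤ Q (i + 1) - P i ∧ Q i - Q (i + 1) ≤ Q (i + 1) - P i))
    (hfar : ∀ i j, i + 1 < j → j < k → Q i ≤ P j ∨ Q j ≤ P i)
    (hcov : ∀ x, 1 ≤ x → x ≤ n → ∃ i < k, P i < x ∧ x < Q i) :
    ∃ a, IsChain k n a ∧ ((∀ i < k, P i = a i ∧ Q i = a (i + 2)) ∨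
      ∀ i < k, P (k - (i + 1)) = a i ∧ Q (k - (i + 1)) = a (i + 2)) := by
  -- If the direction turned at `i + 1`, windows `i` and `i + 2` would straddle the same end of
  -- window `i + 1` and could not be disjoint.
  have step : ∀ i, i + 2 < k → (P i < P (i + 1) ↔ P (i + 1) < P (i + 2)) := by
    intro i hi
    have h1 := hadj i (by omega)
    have h2 := hadj (i + 1) hi
    have h3 := hfar i (i + 2) (by omega) hi
    simp only [add_assoc, Nat.reduceAdd] at h2
    constructor <;> intro <;> omega
  have all : ∀ i, i + 1 < k → (P 0 < P 1 ↔ P i < P (i + 1)) := by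
    intro i
    induction i with
    | zero => exact fun _ => Iff.rfl
    | succ i ih => exact fun hi => (ih (by omega)).trans (step i hi)
  by_cases h0 : P 0 < P 1
  · obtain ⟨a, ha, h⟩ := exists_isChain_of_right hk hn hPQ (fun i hi => by
      have h1 := hadj i hi
      have h2 := (all i hi).1 h0
      omega) hfar hcov
    exact ⟨a, ha, Or.inl h⟩
  · obtain ⟨a, ha, h⟩ := exists_isChain_of_right (P := fun i => P (k - (i + 1)))
      (Q := fun i => Q (k - (i + 1))) hk hn (fun i hi => hPQ _ (by omega)) (fun i hi => by
        have h1 := hadj (k - (i + 2)) (by omega)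
        have h2 := mt (all (k - (i + 2)) (by omega)).2 h0
        rw [show k - (i + 2) + 1 = k - (i + 1) by omega] at h1 h2
        simp only [add_assoc, Nat.reduceAdd]
        omega) (fun i j hij hj => (hfar (k - (j + 1)) (k - (i + 1)) (by omega) (by omega)).symm)
      (fun x h1 h2 => by
        obtain ⟨i, hi, h3⟩ := hcov x h1 h2
        refine ⟨k - (i + 1), by omega, ?_⟩
        rwa [show k - (k - (i + 1) + 1) = i by omega])
    exact ⟨a, ha, Or.inr h⟩

/-! ### The converse -/

theorem singleton_eq_cutSet (i : Fin k) : ({i} : Set (Fin k)) = cutSet k i (i + 2) := by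
  ext x
  simp only [Set.mem_singleton_iff, cutSet, Set.mem_ofPred_eq, Fin.ext_iff]
  omega

theorem isPsiUpToDiagramAut_of_locallyInjective (hk : 1 ≤ k) (hn : 1 ≤ n)
    {φ : Hecke (CoxeterMatrix.A k) →* Hecke (CoxeterMatrix.A n)} (hφ : LocallyInjective φ)
    (hc : IsConnectedHom φ) (hf : FullySupported φ) : IsPsiUpToDiagramAut φ := by
  have hJ : ∀ i, Absorbs (supp (φ (gen _ i))) (φ (gen (CoxeterMatrix.A k) i)) := fun i =>
    absorbs_of_idem (by rw [← map_mul, gen_idem])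
  have hg : ∀ i : Fin k, Absorbs (cutSet k i (i + 2)) (gen (CoxeterMatrix.A k) i) := fun i =>
    singleton_eq_cutSet i ▸ absorbs_singleton i
  have hmem : ∀ i j : Fin k, gen (CoxeterMatrix.A k) i ∈
      parabolicSubmonoid (CoxeterMatrix.A k) {i, j} := fun i j =>
    Submonoid.subset_closure ⟨i, Or.inl rfl, rfl⟩
  have hmem' : ∀ i j : Fin k, gen (CoxeterMatrix.A k) j ∈
      parabolicSubmonoid (CoxeterMatrix.A k) {i, j} := fun i j =>
    Submonoid.subset_closure ⟨j, Or.inr rfl, rfl⟩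
  -- An empty support means that the generator maps to 1. Local injectivity excludes this if there
  -- is a second generator; for `k = 1` that condition is vacuous and full support is used.
  have hne : ∀ i, (supp (φ (gen (CoxeterMatrix.A k) i))).Nonempty := by
    intro i
    by_cases hk1 : k = 1
    · subst hk1
      have h1 : (⟨0, hn⟩ : Fin n) ∈ suppMap φ Set.univ := hf ▸ Set.mem_univ _
      simp only [suppMap, Set.mem_iUnion] at h1
      obtain ⟨j, -, h1⟩ := h1
      rw [Subsingleton.elim i j]
      exact ⟨_, h1⟩
    · rw [Set.nonempty_iff_ne_empty]
      intro he
      obtain ⟨j, hj⟩ : ∃ j : Fin k, i ≠ j := by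
        by_cases h0 : (i : ℕ) = 0
        · exact ⟨⟨1, by omega⟩, fun e => by simp [e] at h0⟩
        · exact ⟨⟨0, by omega⟩, fun e => h0 (by simp [e])⟩
      have h1 : φ (gen _ i) = φ 1 := by
        rw [map_one, (hJ i).eq_wLong, he, wLong_empty]
      have h2 : gen (CoxeterMatrix.A k) i = 1 := hφ i j hj (hmem i j) (one_mem _) h1
      exact mem_of_mul_gen_eq (J := ∅) (one_mem _) (by rw [h2, one_mul] : 1 * gen _ i = 1)
  have hex : ∀ i : ℕ, ∃ p q, ∀ h : i < k, p + 2 ≤ q ∧ q ≤ n + 1 ∧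
      supp (φ (gen (CoxeterMatrix.A k) ⟨i, h⟩)) = cutSet n p q := by
    intro i
    by_cases h : i < k
    · have h1 := hc {⟨i, h⟩} (fun x y => by
        rw [Subsingleton.elim x y])
      rw [suppMap_singleton, connectedSubset_A_iff] at h1
      obtain ⟨p, q, h2, h3, h4⟩ := exists_cutSet_of_ordConnected h1 (hne _)
      exact ⟨p, q, fun _ => ⟨h2, h3, h4⟩⟩
    · exact ⟨0, 0, fun h' => absurd h' h⟩
  choose P Q hPQ using hex
  have hA : ∀ i (h : i < k), Absorbs (cutSet n (P i) (Q i)) (φ (gen _ ⟨i, h⟩)) := fun i h =>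
    (hPQ i h).2.2 ▸ hJ ⟨i, h⟩
  obtain ⟨a, ha, h⟩ := exists_isChain (P := P) (Q := Q) hk hn
    (fun i hi => ⟨(hPQ i hi).1, (hPQ i hi).2.1⟩) (fun i hi => by
      have hi' : i < k := by omega
      have h1 := mul_ne_of_overlap (hg ⟨i, hi'⟩) (hg ⟨i + 1, hi⟩) (by simp) (by simp) (by simp)
        (by simp; omega)
      have hij : (⟨i, hi'⟩ : Fin k) ≠ ⟨i + 1, hi⟩ := by simp
      have m1 := hmem ⟨i, hi'⟩ ⟨i + 1, hi⟩
      have m2 := hmem' ⟨i, hi'⟩ ⟨i + 1, hi⟩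
      have b := (braidFamily_gen k).braid ⟨i, hi'⟩ ⟨i + 1, hi⟩ rfl
      have := (hPQ i hi').1
      have := (hPQ _ hi).1
      apply overlap_cases (hA i hi') (hA (i + 1) hi) (by omega) (by omega) (hPQ i hi').2.1
        (hPQ _ hi).2.1
      · simp only [← map_mul, b]
      · simp only [← map_mul]
        exact fun e => h1.1 (hφ _ _ hij (mul_mem m1 m2) (mul_mem (mul_mem m1 m2) m1) e)
      · simp only [← map_mul]
        exact fun e => h1.2 (hφ _ _ hij (mul_mem m2 m1) (mul_mem (mul_mem m1 m2) m1) e))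
    (fun i j hij hj => by
      have hi : i < k := by omega
      have hne : (⟨i, hi⟩ : Fin k) ≠ ⟨j, hj⟩ := by simp; omega
      have m1 := hmem ⟨i, hi⟩ ⟨j, hj⟩
      have m2 := hmem' ⟨i, hi⟩ ⟨j, hj⟩
      have b := (braidFamily_gen k).comm ⟨i, hi⟩ ⟨j, hj⟩ hij
      apply disjoint_cases (hA i hi) (hA j hj) (hPQ i hi).2.1 (hPQ j hj).2.1
      · simp only [← map_mul, b]
      · rw [← map_mul]
        intro e
        have e1 := (absorbs_singleton _).subset_of_mul_eq (absorbs_singleton _)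
          (hφ _ _ hne (mul_mem m1 m2) m1 e)
        exact hne (e1 rfl).symm
      · rw [← map_mul]
        intro e
        have e1 := hφ _ _ hne (mul_mem m1 m2) m2 e
        rw [b] at e1
        exact hne ((absorbs_singleton _).subset_of_mul_eq (absorbs_singleton _) e1 rfl))
    (fun x h1 h2 => by
      have h3 : (⟨x - 1, by omega⟩ : Fin n) ∈ suppMap φ Set.univ := hf ▸ Set.mem_univ _
      simp only [suppMap, Set.mem_iUnion] at h3
      obtain ⟨j, -, h3⟩ := h3
      rw [(hPQ j j.2).2.2] at h3
      simp only [cutSet, Set.mem_ofPred_eq] at h3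
      exact ⟨j, j.2, by omega, by omega⟩)
  rcases h with h | h
  · refine ha.isPsiUpToDiagramAut hk fun i => ?_
    rw [(hA i i.2).eq_wLong, (h i i.2).1, (h i i.2).2]
  -- The windows march from right to left, so the generators of the source are renumbered by the
  -- reversal.
  · have h1 : IsPsiUpToDiagramAut (φ.comp (diagramHom (revAut k))) := by
      refine ha.isPsiUpToDiagramAut hk fun i => ?_
      rw [MonoidHom.comp_apply, diagramHom_gen, (hA _ ((revAut k).1 i).2).eq_wLong, revAut_val,
        (h i i.2).1, (h i i.2).2]
    have h2 := h1.comp (idAut _) (revAut k)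
    rw [MonoidHom.comp_assoc, diagramHom_revAut_comp, diagramHom_idAut] at h2
    exact h2

/-! ### Parabolic homomorphisms -/

theorem IsLongest.eq_longest {J : Set (Fin n)} {g : (CoxeterMatrix.A n).Group}
    (hg : IsLongest (CoxeterMatrix.A n) J g) : g = longest (CoxeterMatrix.A n) J :=
  ofGroup_injective hg.absorbs.eq_wLong

theorem longest_mul_self (J : Set (Fin n)) :
    longest (CoxeterMatrix.A n) J * longest (CoxeterMatrix.A n) J = 1 := by
  have h := isLongest_longest J
  have h1 : IsLongest (CoxeterMatrix.A n) J (longest (CoxeterMatrix.A n) J)⁻¹ :=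
    ⟨inv_mem h.1, fun v hv => by rw [CoxeterSystem.length_inv]; exact h.2 v hv⟩
  nth_rw 1 [← h1.eq_longest]
  exact inv_mul_cancel _

theorem longest_empty : longest (CoxeterMatrix.A n) ∅ = 1 := by
  have h : (longest (CoxeterMatrix.A n) ∅) ∈ parabolicSubgroup (CoxeterMatrix.A n) ∅ :=
    (isLongest_longest ∅).1
  rwa [parabolicSubgroup, Set.image_empty, Subgroup.closure_empty, Subgroup.mem_bot] at h

theorem ofGroup_one : ofGroup (1 : (CoxeterMatrix.A n).Group) = 1 := by
  have h := wLong_empty (n := n)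
  rwa [wLong, longest_empty] at h

/-- The image absorbs each φ(s_j) with `j ∈ K`, hence also every generator in the support of φ(s_j).
This settles parabolicity for `J' = ∅`. -/
theorem map_wLong {φ : Hecke (CoxeterMatrix.A k) →* Hecke (CoxeterMatrix.A n)}
    (K : Set (Fin k)) : φ (wLong K) = wLong (suppMap φ K) := by
  have hJ : ∀ i, Absorbs (supp (φ (gen _ i))) (φ (gen (CoxeterMatrix.A k) i)) := fun i =>
    absorbs_of_idem (by rw [← map_mul, gen_idem])
  have hK : parabolicSubmonoid (CoxeterMatrix.A k) K ≤
      (parabolicSubmonoid (CoxeterMatrix.A n) (suppMap φ K)).comap φ := by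
    rw [parabolicSubmonoid, Submonoid.closure_le]
    rintro _ ⟨j, hj, rfl⟩
    exact parabolicSubmonoid_mono _ (Set.subset_biUnion_of_mem (u := fun j => supp (φ (gen _ j))) hj)
      (hJ j).mem
  refine Absorbs.eq_wLong ⟨hK (absorbs_wLong K).mem, fun i hi => ?_⟩
  simp only [suppMap, Set.mem_iUnion] at hi
  obtain ⟨j, hj, hi⟩ := hi
  rw [← (absorbs_wLong K).mul_gen j hj, map_mul, mul_assoc, (hJ j).mul_gen i hi]

theorem toPerm_longest_univ : toPerm n (longest (CoxeterMatrix.A n) Set.univ) = Fin.revPerm := by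
  apply ofPerm_injective
  have h : Absorbs Set.univ (ofPerm (Fin.revPerm : Equiv.Perm (Fin (n + 1)))) :=
    ⟨ofPerm_mem fun i hi => absurd (Set.mem_univ i) hi, fun i _ => ofPerm_mul_gen_of_gt (by
      rw [Fin.revPerm_apply, Fin.revPerm_apply, Fin.rev_lt_rev]; exact i.castSucc_lt_succ)⟩
  rw [h.eq_wLong, wLong, ofGroup_eq]

theorem toPerm_longest_singleton (i : Fin n) :
    toPerm n (longest (CoxeterMatrix.A n) {i}) = adjSwap i := by
  apply ofPerm_injective
  have h := wLong_singleton i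
  rw [wLong, ofGroup_eq] at h
  rw [ofPerm, h, ofPerm, ← one_mul (adjSwap i), reducedProd_mul_of_lt (braidFamily_gen n)
    (by simp), reducedProd_one (braidFamily_gen n), one_mul]

theorem revPerm_mul_adjSwap (i : Fin n) :
    (Fin.revPerm : Equiv.Perm (Fin (n + 1))) * adjSwap i = adjSwap i.rev * Fin.revPerm := by
  ext x
  have hx := x.2
  have hi := i.2
  simp only [Equiv.Perm.mul_apply, Fin.revPerm_apply, Fin.val_rev, adjSwap_val]
  split_ifs <;> omega

/-- The step to w_∘ is an ascent, so x = w_∘ s_i in the group; moving s_i across the reversal turns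
`i` into `i.rev`. -/
theorem eq_ofGroup_parabolicElement_singleton {x : Hecke (CoxeterMatrix.A n)} (i : Fin n)
    (h1 : x ≠ wLong Set.univ) (h2 : x * gen _ i = wLong Set.univ) :
    x = ofGroup (parabolicElement (CoxeterMatrix.A n) {i.rev} Set.univ) := by
  obtain ⟨w, rfl⟩ := ofPerm_surjective x
  rw [parabolicElement, ofGroup_eq, map_mul, toPerm_longest_univ, toPerm_longest_singleton,
    ← revPerm_mul_adjSwap]
  rw [wLong, ofGroup_eq, toPerm_longest_univ] at h1 h2
  rcases lt_or_gt_succ w i with h | h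
  · rw [ofPerm_mul_gen_of_lt h] at h2
    rw [← ofPerm_injective h2, mul_assoc, adjSwap_mul_self, mul_one]
  · rw [ofPerm_mul_gen_of_gt h] at h2
    exact absurd h2 h1

theorem univ_eq_cutSet : (Set.univ : Set (Fin n)) = cutSet n 0 (n + 1) := by
  ext x
  simp [cutSet]

/-- The two elements of length two of the Hecke monoid of type `A_2`. -/
theorem ofGroup_parabolicElement_A_two (i : Fin 2) :
    ofGroup (parabolicElement (CoxeterMatrix.A 2) {i} Set.univ) =
      gen (CoxeterMatrix.A 2) i.rev * gen (CoxeterMatrix.A 2) i := by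
  have h0 : Absorbs (cutSet 2 0 2) (gen (CoxeterMatrix.A 2) 0) :=
    singleton_eq_cutSet (0 : Fin 2) ▸ absorbs_singleton 0
  have h1 : Absorbs (cutSet 2 1 3) (gen (CoxeterMatrix.A 2) 1) :=
    singleton_eq_cutSet (1 : Fin 2) ▸ absorbs_singleton 1
  have h2 := braid_of_overlap h0 h1 (by decide) (by decide) (by decide) (by decide) (by decide)
    (by decide)
  have h3 := mul_ne_of_overlap h0 h1 (by decide) (by decide) (by decide) (by decide)
  have h4 := h2.1.eq_wLong
  rw [← univ_eq_cutSet (n := 2)] at h4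
  have h5 := h4
  rw [h2.2] at h5
  fin_cases i
  · exact (eq_ofGroup_parabolicElement_singleton (1 : Fin 2) (h4 ▸ h3.2) h5).symm
  · exact (eq_ofGroup_parabolicElement_singleton (0 : Fin 2) (h4 ▸ h3.1) h4).symm

theorem count_last (t : ℕ) (w : Equiv.Perm (Fin (n + 1))) :
    count t w (n + 1) = n + 1 - t := by
  rw [← act_ofPerm, act_of_notMem (J := Set.univ) (ofPerm_mem fun i hi => absurd (Set.mem_univ i) hi) _
    (fun j _ => by omega), count_one, base_apply, min_self]

/-- The first `n + 1 - i` places of the reversed word are the last ones of the original, so the two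
counts add up to all values `≥ t`. -/
theorem count_mul_revPerm (t : ℕ) (w : Equiv.Perm (Fin (n + 1))) {i : ℕ} (hi : i ≤ n + 1) :
    count t w i + count t (w * Fin.revPerm) (n + 1 - i) = n + 1 - t := by
  induction i with
  | zero => rw [count_zero, zero_add, Nat.sub_zero, count_last]
  | succ i ih =>
    have h1 := count_succ_val t w ⟨i, hi⟩
    have h2 := count_succ_val t (w * Fin.revPerm) (Fin.rev ⟨i, hi⟩)
    have h3 : ((Fin.rev ⟨i, hi⟩ : Fin (n + 1)) : ℕ) = n + 1 - (i + 1) := Fin.val_rev _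
    rw [Equiv.Perm.mul_apply, Fin.revPerm_apply, Fin.rev_rev, h3,
      show n + 1 - (i + 1) + 1 = n + 1 - i by omega] at h2
    have := ih (by omega)
    simp only at h1
    omega

/-- The height function of `w_∘^J` in terms of the one of `w_∘^J w_∘`. -/
theorem act_wLong_eq {x : Hecke (CoxeterMatrix.A n)} {J : Set (Fin n)}
    (hx : x = ofGroup (parabolicElement (CoxeterMatrix.A n) J Set.univ)) (t : ℕ) {i : ℕ}
    (hi : i ≤ n + 1) :
    act (base n t) (wLong J) i + act (base n t) x (n + 1 - i) = n + 1 - t := by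
  rw [hx, wLong, ofGroup_eq, ofGroup_eq, ← count_one, act_ofPerm, act_ofPerm, parabolicElement,
    map_mul, toPerm_longest_univ]
  exact count_mul_revPerm t _ hi

/-- Cancelling the reversal in y x leaves the one-line word p, …, p+n-q, 0, …, p-1, followed by
fixed points. Its only descent is at `n - q`. As w_∘^J it must descend at each `j ∈ J` and preserve
every other cut, so both exchanged blocks have length one. -/
theorem one_of_parabolic {p q : ℕ} {x y : Hecke (CoxeterMatrix.A n)} {J : Set (Fin n)}
    (hx : Absorbs (cutSet n 0 q) x) (hy : Absorbs (cutSet n p (n + 1)) y) (h1 : 0 < p)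
    (h2 : p < q) (h3 : q < n + 1) (h4 : p ≤ q - p)
    (h : y * x = ofGroup (parabolicElement (CoxeterMatrix.A n) J Set.univ)) :
    p = 1 ∧ q = n := by
  have key : ∀ t i, i ≤ n + 1 → act (base n t) (wLong J) i +
      (if 0 < n + 1 - i ∧ n + 1 - i < q then
        min (base n t 0 + (n + 1 - i - 0)) (if p < q ∧ q < n + 1 then
          min (base n t p + (q - p)) (base n t (n + 1)) else base n t q) else
        if p < n + 1 - i ∧ n + 1 - i < n + 1 then
          min (base n t p + (n + 1 - i - p)) (base n t (n + 1)) else base n t (n + 1 - i)) =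
      n + 1 - t := by
    intro t i hi
    have := act_wLong_eq h t hi
    rw [act_mul, hx.act_cutSet (by omega), hy.act_cutSet le_rfl, hy.act_cutSet le_rfl,
      hy.act_cutSet le_rfl] at this
    simpa [h1] using this
  have out : ∀ j : Fin n, j ∉ J → ∀ t, act (base n t) (wLong J) (j + 1) = base n t (j + 1) :=
    fun j hj t => act_of_notMem (absorbs_wLong J).mem _ fun i hi e => hj (by
      rwa [show j = i from Fin.ext (by omega)])
  have inn : ∀ j : Fin n, j ∈ J → ∀ t, act (base n t) (wLong J) (j + 1) =
      min (act (base n t) (wLong J) j + 1) (act (base n t) (wLong J) (j + 2)) := by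
    intro j hj t
    have := congrArg (fun y => act (base n t) y (j + 1)) ((absorbs_wLong J).mul_gen j hj)
    simp only [act_mul, act_gen, Height.sort_self] at this
    exact this.symm
  simp only [base_apply] at key out
  have hb : (⟨n - q, by omega⟩ : Fin n) ∈ J := by
    by_contra hJ
    have h6 := out _ hJ p
    have h7 := key p (n - q + 1) (by omega)
    simp only at h6
    split_ifs at h7 <;> omega
  constructor
  · by_contra hp
    have hJ : (⟨n - q + 1, by omega⟩ : Fin n) ∈ J := by
      by_contra hJ
      have h6 := out _ hJ p
      have h7 := key p (n - q + 1 + 1) (by omega)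
      simp only at h6
      split_ifs at h7 <;> omega
    -- The values in places `n - q + 1` and `n - q + 2` are 0 and 1: the threshold 1 exposes the
    -- ascent.
    have h6 := inn _ hJ 1
    have h7 := key 1 (n - q + 1) (by omega)
    have h8 := key 1 (n - q + 1 + 1) (by omega)
    have h9 := key 1 (n - q + 1 + 2) (by omega)
    simp only at h6
    rw [if_neg (by omega), if_pos (by omega)] at h7
    rw [if_pos (by omega), if_pos (by omega)] at h8 h9
    omega
  · by_contra hq
    have hJ : (⟨n - q - 1, by omega⟩ : Fin n) ∈ J := by
      by_contra hJ
      have h6 := out _ hJ p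
      have h7 := key p (n - q - 1 + 1) (by omega)
      simp only at h6
      split_ifs at h7 <;> omega
    -- The threshold separates p+n-q-1 from p+n-q, the last two values of the first block.
    have h6 := inn _ hJ (p + n - q)
    have h7 := key (p + n - q) (n - q - 1) (by omega)
    have h8 := key (p + n - q) (n - q - 1 + 1) (by omega)
    have h9 := key (p + n - q) (n - q - 1 + 2) (by omega)
    simp only at h6
    rw [if_neg (by omega)] at h7
    rw [if_neg (by omega), if_pos (by omega)] at h8 h9
    split_ifs at h7 <;> omega

theorem isParabolic_iff {l : Fin 3 → ℕ} (hn : 2 ≤ n) (hl : l ∈ restrictedPartitions 3 (n + 1))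
    {ψ : Hecke (CoxeterMatrix.A 2) →* Hecke (CoxeterMatrix.A n)} (hψ : IsPsi l ψ) :
    IsParabolic ψ ↔ l = ![n - 1, 1, 1] := by
  have hch := isChain_partialSum hl
  have P1 : partialSum l 1 = l 2 := partialSum_one l
  have P2 : partialSum l 2 = l 2 + l 0 := by
    rw [← P1]; exact partialSum_succ l 0 (by decide)
  have P3 : partialSum l 3 = n + 1 := hch.last
  have hsum : l 0 + l 1 + l 2 = n + 1 := by
    rw [← hl.2.2.2, Fin.sum_univ_three]
  have hpos := hl.1
  have p0 := hpos 0
  have p1 := hpos 1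
  have p2 := hpos 2
  have a1 : l 1 ≤ l 0 := hl.2.1 (by decide)
  have a2 : l 2 ≤ l 0 := hl.2.1 (by decide)
  have hx : Absorbs (cutSet n 0 (l 2 + l 0)) (ψ (gen (CoxeterMatrix.A 2) 0)) := by
    have := absorbs_wLong (interval n l 0)
    rw [wLong, ← hψ 0, interval_eq_cutSet] at this
    rw [← P2]
    exact this
  have hy : Absorbs (cutSet n (l 2) (n + 1)) (ψ (gen (CoxeterMatrix.A 2) 1)) := by
    have := absorbs_wLong (interval n l 1)
    rw [wLong, ← hψ 1, interval_eq_cutSet] at this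
    rw [← P1, ← P3]
    exact this
  have huniv : suppMap ψ Set.univ = Set.univ := by
    rw [Set.eq_univ_iff_forall]
    intro z
    simp only [suppMap, Set.mem_iUnion, Set.mem_univ, exists_prop, true_and]
    by_cases hz : (z : ℕ) + 1 < l 2 + l 0
    · refine ⟨0, ?_⟩
      rw [hx.supp_eq]
      simp only [cutSet, Set.mem_ofPred_eq]
      omega
    · refine ⟨1, ?_⟩
      rw [hy.supp_eq]
      simp only [cutSet, Set.mem_ofPred_eq]
      omega
  constructor
  · intro h
    -- The single test element s_2 s_1, with image y x, already decides the shape of λ.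
    obtain ⟨J, -, hJ⟩ := h Set.univ (inferInstanceAs (Finite (parabolicSubgroup _ _))) {0} (Set.subset_univ _)
    rw [huniv, ofGroup_parabolicElement_A_two, map_mul] at hJ
    have := one_of_parabolic hx hy p2 (by omega) (by omega) (by omega) hJ
    ext i
    fin_cases i
    · change l 0 = n - 1; omega
    · change l 1 = 1; omega
    · change l 2 = 1; omega
  · intro h
    have e0 : l 0 = n - 1 := congrFun h 0
    have e2 : l 2 = 1 := congrFun h 2
    rw [show l 2 + l 0 = n by omega] at hx
    rw [e2] at hy
    have hb := braid_of_overlap hx hy Nat.one_pos (by omega) (by omega) le_rfl (by omega) (by omega)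
    have hne := mul_ne_of_overlap hx hy Nat.one_pos (by omega) (by omega) le_rfl
    have hz := hb.1.eq_wLong
    rw [← univ_eq_cutSet] at hz
    have hz' : Absorbs (cutSet n 0 (n + 1)) (wLong (Set.univ : Set (Fin n))) :=
      univ_eq_cutSet ▸ absorbs_wLong Set.univ
    -- With p = 1 and q = n both exchanged blocks are single points, so y x and x y are each one
    -- generator short of w_∘.
    have e1 : ψ (gen _ 1) * ψ (gen _ 0) * gen (CoxeterMatrix.A n) ⟨n - 1, by omega⟩ =
        wLong Set.univ := hecke_ext fun c i => by
      have m1 := c.mono (i := 0) (j := 1) (by omega)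
      have l1 := c.le_add (i := 0) (j := 1) (by omega)
      have l2 := c.le_add (i := 1) (j := n) (by omega)
      have m2 := c.mono (i := n) (j := n + 1) (by omega)
      have l3 := c.le_add (i := n) (j := n + 1) (by omega)
      simp only [act_mul, act_gen, Height.sort_apply, hz'.act_cutSet le_rfl, hx.act_cutSet n.le_succ,
        hy.act_cutSet le_rfl]
      rw [show n - 1 + 2 = n + 1 by omega]
      split_ifs <;> omega
    have e2 : ψ (gen _ 0) * ψ (gen _ 1) * gen (CoxeterMatrix.A n) ⟨0, by omega⟩ =
        wLong Set.univ := hecke_ext fun c i => by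
      have m1 := c.mono (i := 0) (j := 1) (by omega)
      have l1 := c.le_add (i := 0) (j := 1) (by omega)
      have l2 := c.le_add (i := 1) (j := n) (by omega)
      have m2 := c.mono (i := n) (j := n + 1) (by omega)
      have l3 := c.le_add (i := n) (j := n + 1) (by omega)
      have m3 := c.mono (i := 1) (j := n) (by omega)
      simp only [act_mul, act_gen, Height.sort_apply, hz'.act_cutSet le_rfl, hx.act_cutSet n.le_succ,
        hy.act_cutSet le_rfl]
      split_ifs <;> omega
    have main : ∀ i : Fin 2, ∃ J, ψ (ofGroup (parabolicElement (CoxeterMatrix.A 2) {i} Set.univ)) =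
        ofGroup (parabolicElement (CoxeterMatrix.A n) J Set.univ) := by
      intro i
      rw [ofGroup_parabolicElement_A_two, map_mul]
      fin_cases i
      · exact ⟨_, eq_ofGroup_parabolicElement_singleton _ (hz ▸ hne.2) e1⟩
      · exact ⟨_, eq_ofGroup_parabolicElement_singleton _ (hz ▸ hne.1) e2⟩
    intro K' _ J' hJ'
    -- With only two generators, `J'` is empty, all of `K'`, or a single generator in the full set;
    -- only the last case depends on λ.
    rcases Set.eq_empty_or_nonempty J' with rfl | hJ1
    · refine ⟨∅, Set.empty_subset _, ?_⟩
      rw [parabolicElement, parabolicElement, longest_empty, longest_empty, one_mul, one_mul]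
      exact map_wLong K'
    by_cases hJK : J' = K'
    · subst hJK
      refine ⟨_, subset_rfl, ?_⟩
      rw [parabolicElement, parabolicElement, longest_mul_self, longest_mul_self, ofGroup_one,
        ofGroup_one, map_one]
    obtain ⟨i, hi⟩ := hJ1
    obtain ⟨j, hj, hjJ⟩ := Set.exists_of_ssubset (hJ'.ssubset_of_ne hJK)
    have hij : i ≠ j := by rintro rfl; exact hjJ hi
    have h2 : ∀ z, z = i ∨ z = j := by omega
    have hK : K' = Set.univ := Set.eq_univ_of_forall fun z => by
      rcases h2 z with rfl | rfl
      · exact hJ' hi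
      · exact hj
    have hJi : J' = {i} := Set.eq_singleton_iff_unique_mem.2 ⟨hi, fun z hz => by
      rcases h2 z with rfl | rfl
      · rfl
      · exact absurd hz hjJ⟩
    obtain ⟨J, hJ⟩ := main i
    rw [hK, hJi, huniv]
    exact ⟨J, Set.subset_univ _, hJ⟩

/-! ### Existence, uniqueness and injectivity of ψ_λ -/

theorem existsUnique_isPsi {l : Fin (k + 1) → ℕ}
    (hl : l ∈ restrictedPartitions (k + 1) (n + 1)) :
    ∃! ψ : Hecke (CoxeterMatrix.A k) →* Hecke (CoxeterMatrix.A n), IsPsi l ψ := by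
  obtain ⟨ψ, hψ⟩ := exists_heckeHom (isChain_partialSum hl).braidFamily
    fun i => (absorbs_wLong _).mul_self
  refine ⟨ψ, fun i => ?_, fun φ hφ => heckeHom_ext fun i => ?_⟩
  · rw [hψ, interval_eq_cutSet]
  · rw [hφ, hψ, interval_eq_cutSet]

theorem IsPsi.locallyInjective_and_isConnectedHom {l : Fin (k + 1) → ℕ}
    (hl : l ∈ restrictedPartitions (k + 1) (n + 1))
    {ψ : Hecke (CoxeterMatrix.A k) →* Hecke (CoxeterMatrix.A n)} (hψ : IsPsi l ψ) :
    LocallyInjective ψ ∧ IsConnectedHom ψ := by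
  have h : ∀ i : Fin k, ψ (gen (CoxeterMatrix.A k) i) =
      wLong (cutSet n (partialSum l i) (partialSum l (i + 2))) := fun i => by
    rw [hψ, interval_eq_cutSet]
  exact ⟨(isChain_partialSum hl).locallyInjective h, (isChain_partialSum hl).isConnectedHom h⟩

theorem injective_of_injOn {N : Type*} [Monoid N] {φ : Hecke (CoxeterMatrix.A 2) →* N}
    (h : Set.InjOn φ (parabolicSubmonoid (CoxeterMatrix.A 2) {0, 1} : Set (Hecke _))) :
    Function.Injective φ := by
  have e : parabolicSubmonoid (CoxeterMatrix.A 2) {0, 1} = ⊤ := by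
    rw [← PresentedMonoid.closure_range_of, parabolicSubmonoid, ← Set.image_univ]
    congr 2
    ext i
    fin_cases i <;> simp
  rw [e, Submonoid.coe_top, Set.injOn_univ] at h
  exact h

end HeckeMonoid

theorem mainTheorem5 :
    (∀ k n : ℕ, 1 ≤ k → 1 ≤ n →
      (∀ l ∈ HeckeMonoid.restrictedPartitions (k + 1) (n + 1),
        (∃! ψ : HeckeMonoid.Hecke (CoxeterMatrix.A k) →* HeckeMonoid.Hecke (CoxeterMatrix.A n),
          HeckeMonoid.IsPsi l ψ) ∧
        (∀ ψ : HeckeMonoid.Hecke (CoxeterMatrix.A k) →* HeckeMonoid.Hecke (CoxeterMatrix.A n),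
          HeckeMonoid.IsPsi l ψ →
            HeckeMonoid.LocallyInjective ψ ∧ HeckeMonoid.IsConnectedHom ψ)) ∧
      (∀ φ : HeckeMonoid.Hecke (CoxeterMatrix.A k) →* HeckeMonoid.Hecke (CoxeterMatrix.A n),
        HeckeMonoid.LocallyInjective φ → HeckeMonoid.IsConnectedHom φ →
          HeckeMonoid.FullySupported φ → HeckeMonoid.IsPsiUpToDiagramAut φ)) ∧
    (∀ n : ℕ, 2 ≤ n →
      (∀ l ∈ HeckeMonoid.restrictedPartitions 3 (n + 1),
        (∃! ψ : HeckeMonoid.Hecke (CoxeterMatrix.A 2) →* HeckeMonoid.Hecke (CoxeterMatrix.A n),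
          HeckeMonoid.IsPsi l ψ) ∧
        (∀ ψ : HeckeMonoid.Hecke (CoxeterMatrix.A 2) →* HeckeMonoid.Hecke (CoxeterMatrix.A n),
          HeckeMonoid.IsPsi l ψ →
            Function.Injective ψ ∧ (HeckeMonoid.IsParabolic ψ ↔ l = ![n - 1, 1, 1]))) ∧
      (∀ φ : HeckeMonoid.Hecke (CoxeterMatrix.A 2) →* HeckeMonoid.Hecke (CoxeterMatrix.A n),
        Function.Injective φ → HeckeMonoid.IsConnectedHom φ →
          HeckeMonoid.FullySupported φ → HeckeMonoid.IsPsiUpToDiagramAut φ)) := by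

  refine ⟨fun k n hk hn => ⟨fun l hl => ⟨HeckeMonoid.existsUnique_isPsi hl,
    fun ψ hψ => hψ.locallyInjective_and_isConnectedHom hl⟩, fun φ h1 h2 h3 =>
    HeckeMonoid.isPsiUpToDiagramAut_of_locallyInjective hk hn h1 h2 h3⟩,
    fun n hn => ⟨fun l hl => ⟨HeckeMonoid.existsUnique_isPsi hl, fun ψ hψ =>
      ⟨HeckeMonoid.injective_of_injOn
        ((hψ.locallyInjective_and_isConnectedHom hl).1 0 1 (by decide)),
        HeckeMonoid.isParabolic_iff hn hl hψ⟩⟩, fun φ h1 h2 h3 =>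
    HeckeMonoid.isPsiUpToDiagramAut_of_locallyInjective one_le_two (one_le_two.trans hn)
      (fun _ _ _ => h1.injOn) h2 h3⟩⟩
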